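/- Let $(M,g)$ be a smooth finite-dimensional Riemannian manifold with Levi-Civita connection $\nabla$. A Kenmotsu structure on $M$ consists of a smooth $(1,1)$-tensor field $\varphi$, a smooth vector field $\xi$ and its $g$-dual $1$-form $\eta$ such that, for all vector fields $X,Y$, $$\varphi^2X=-X+\eta(X)\xi,\quad \eta(\xi)=1,\quad \eta\circ\varphi=0,\quad \varphi\xi=0,\quad g(\varphi X,\varphi Y)=g(X,Y)-\eta(X)\eta(Y),$$ $$(\nabla_X\varphi)Y=g(\varphi X,Y)\,\xi-\eta(Y)\,\varphi X .$$ A $3$-Kenmotsu structure on $M$ consists of three Kenmotsu structures $(\varphi_\alpha,\xi,\eta,g)$, $\alpha=1,2,3$, with common $\xi$, $\eta$, $g$, such that $\varphi_k=\varphi_i\circ\varphi_j$ for every even permutation $(i,j,k)$ of $(1,2,3)$. A Riemannian manifold $(V,h)$ is called quaternion K\"ahler if there is a subbundle $Q\subset\operatorname{End}(TV)$ which near each point is spanned by smooth $(1,1)$-tensor fields $J_1,J_2,J_3$ with $J_\alpha^2=-\mathrm{id}$, $J_iJ_j=-J_jJ_i=J_k$ for all even permutations $(i,j,k)$ of $(1,2,3)$,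 and $h(J_\alpha X,J_\alpha Y)=h(X,Y)$, and which is parallel: if $A$ is a local smooth section of $Q$ and $X$ a tangent vector, then $\bar\nabla_XA\in Q$, where $\bar\nabla$ is the Levi-Civita connection of $h$. (The scalar curvature may be zero; a single point is allowed as the case of dimension $0$.) **Theorem.** Let $M$ be a $3$-Kenmotsu manifold and $p\in M$. Then there are $\varepsilon>0$, $c>0$, $n\ge 0$, a quaternion K\"ahler manifold $(V,h)$ of dimension $4n$, an open neighborhood $U$ of $p$ in $M$ and a diffeomorphism $\Phi\colon(-\varepsilon,\varepsilon)\times V\to U$ which is an isometry from the warped product $(-\varepsilon,\varepsilon)\times_fV$ with $f(t)=ce^t$ onto $(U,g|_U)$, that is, $$\Phi^*g=dt^2+c^2e^{2t}\,h .$$ -/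

import Mathlib

open Bundle Set
open scoped Manifold ContDiff Topology

noncomputable section

namespace ThreeKenmotsu

/-- A smooth Riemannian metric on a manifold `M` modelled on the vector space `E`. -/
abbrev Metric (E : Type*) [NormedAddCommGroup E] [NormedSpace ℝ E]
    (M : Type*) [TopologicalSpace M] [ChartedSpace E M] [IsManifold 𝓘(ℝ, E) ∞ M] :=
  ContMDiffRiemannianMetric 𝓘(ℝ, E) ∞ E (fun x : M ↦ TangentSpace 𝓘(ℝ, E) x)

section

variable {E : Type*} [NormedAddCommGroup E] [NormedSpace ℝ E]
  {M : Type*} [TopologicalSpace M] [ChartedSpace E M] [IsManifold 𝓘(ℝ, E) ∞ M]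

/-- Smoothness on `s` of a vector field. -/
def SmoothField (X : Π x : M, TangentSpace 𝓘(ℝ, E) x) (s : Set M) : Prop :=
  ContMDiffOn 𝓘(ℝ, E) (𝓘(ℝ, E).prod 𝓘(ℝ, E)) ∞
    (fun x ↦ TotalSpace.mk' E (E := fun x : M ↦ TangentSpace 𝓘(ℝ, E) x) x (X x)) s

/-- Smoothness on `s` of a `1`-form. -/
def SmoothForm (η : Π x : M, TangentSpace 𝓘(ℝ, E) x →L[ℝ] ℝ) (s : Set M) : Prop :=
  ContMDiffOn 𝓘(ℝ, E) (𝓘(ℝ, E).prod 𝓘(ℝ, E →L[ℝ] ℝ)) ∞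
    (fun x ↦ TotalSpace.mk' (E →L[ℝ] ℝ)
      (E := fun x : M ↦ (TangentSpace 𝓘(ℝ, E) x →L[ℝ] ℝ)) x (η x)) s

/-- Smoothness on `s` of a `(1,1)`-tensor field, i.e. of a field of endomorphisms of the tangent
spaces. -/
def SmoothEnd (A : Π x : M, TangentSpace 𝓘(ℝ, E) x →L[ℝ] TangentSpace 𝓘(ℝ, E) x)
    (s : Set M) : Prop :=
  ContMDiffOn 𝓘(ℝ, E) (𝓘(ℝ, E).prod 𝓘(ℝ, E →L[ℝ] E)) ∞
    (fun x ↦ TotalSpace.mk' (E →L[ℝ] E)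
      (E := fun x : M ↦ (TangentSpace 𝓘(ℝ, E) x →L[ℝ] TangentSpace 𝓘(ℝ, E) x)) x (A x)) s

/-! ### The Levi-Civita connection -/

/-- The right-hand side of the Koszul formula for `2 g(∇_X Y, Z)`. -/
def koszul (g : Metric E M) (X Y Z : Π x : M, TangentSpace 𝓘(ℝ, E) x) (x : M) : ℝ :=
  mvfderiv 𝓘(ℝ, E) (fun y ↦ g.inner y (Y y) (Z y)) x (X x)
    + mvfderiv 𝓘(ℝ, E) (fun y ↦ g.inner y (X y) (Z y)) x (Y x)
    - mvfderiv 𝓘(ℝ, E) (fun y ↦ g.inner y (X y) (Y y)) x (Z x)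
    + g.inner x (VectorField.mlieBracket 𝓘(ℝ, E) X Y x) (Z x)
    - g.inner x (VectorField.mlieBracket 𝓘(ℝ, E) X Z x) (Y x)
    - g.inner x (VectorField.mlieBracket 𝓘(ℝ, E) Y Z x) (X x)

/-- `L` is the covariant differential `X ↦ ∇_X Y` at `x`, according to the Koszul formula. -/
def IsKoszulDerivAt (g : Metric E M) (Y : Π x : M, TangentSpace 𝓘(ℝ, E) x) (x : M)
    (L : TangentSpace 𝓘(ℝ, E) x →L[ℝ] TangentSpace 𝓘(ℝ, E) x) : Prop :=
  ∀ X Z : Π x : M, TangentSpace 𝓘(ℝ, E) x, MDiffAt (T% X) x → MDiffAt (T% Z) x →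
    2 * g.inner x (L (X x)) (Z x) = koszul g X Y Z x

open Classical in
/-- The Levi-Civita connection of `g`: `leviCivita g Y x v` is `∇_v Y`, for a tangent vector `v`
at `x` and a vector field `Y` that is differentiable at `x`. It is given by the Koszul formula,
which determines it; see `leviCivita_koszul`. (The value is `0` if `Y` is too irregular.) -/
def leviCivita (g : Metric E M) (Y : Π x : M, TangentSpace 𝓘(ℝ, E) x) (x : M) :
    TangentSpace 𝓘(ℝ, E) x →L[ℝ] TangentSpace 𝓘(ℝ, E) x :=
  if h : ∃ L, IsKoszulDerivAt g Y x L then h.choose else 0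

section Koszul

variable {g : Metric E M} {X Y Z : Π x : M, TangentSpace 𝓘(ℝ, E) x} {x : M}

theorem mdifferentiableAt_inner (hX : MDiffAt (T% X) x) (hY : MDiffAt (T% Y) x) :
    MDiffAt (fun y ↦ g.inner y (X y) (Y y)) x := by
  have hg := (g.contMDiff x).mdifferentiableAt (by simp)
  have := MDifferentiableAt.clm_bundle_apply₂ (E₃ := fun _ : M ↦ ℝ) hg hX hY
  rw [mdifferentiableAt_totalSpace] at this
  exact this.2

theorem tensorialAt_koszul_left [CompleteSpace E] (hY : MDiffAt (T% Y) x)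
    (hZ : MDiffAt (T% Z) x) : TensorialAt 𝓘(ℝ, E) E (fun X ↦ koszul g X Y Z x) x where
  smul {f X} hf hX := by
    have e1 : (fun y ↦ g.inner y ((f • X) y) (Z y)) = f * (fun y ↦ g.inner y (X y) (Z y)) := by
      ext y; simp
    have e2 : (fun y ↦ g.inner y ((f • X) y) (Y y)) = f * (fun y ↦ g.inner y (X y) (Y y)) := by
      ext y; simp
    simp only [koszul, e1, e2, mvfderiv_mul hf (mdifferentiableAt_inner hX hZ),
      mvfderiv_mul hf (mdifferentiableAt_inner hX hY), VectorField.mlieBracket_smul_left hf hX]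
    simp
    simp [g.symm x (X x) (Z x), g.symm x (X x) (Y x)]
    ring
  add {X X'} hX hX' := by
    have e1 : (fun y ↦ g.inner y ((X + X') y) (Z y))
        = (fun y ↦ g.inner y (X y) (Z y)) + (fun y ↦ g.inner y (X' y) (Z y)) := by
      ext y; simp
    have e2 : (fun y ↦ g.inner y ((X + X') y) (Y y))
        = (fun y ↦ g.inner y (X y) (Y y)) + (fun y ↦ g.inner y (X' y) (Y y)) := by
      ext y; simp
    simp only [koszul, e1, e2,
      mvfderiv_add (mdifferentiableAt_inner hX hZ) (mdifferentiableAt_inner hX' hZ),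
      mvfderiv_add (mdifferentiableAt_inner hX hY) (mdifferentiableAt_inner hX' hY),
      VectorField.mlieBracket_add_left hX hX']
    simp
    ring

theorem tensorialAt_koszul_right [CompleteSpace E] (hX : MDiffAt (T% X) x)
    (hY : MDiffAt (T% Y) x) : TensorialAt 𝓘(ℝ, E) E (fun Z ↦ koszul g X Y Z x) x where
  smul {f Z} hf hZ := by
    have e1 : (fun y ↦ g.inner y (Y y) ((f • Z) y)) = f * (fun y ↦ g.inner y (Y y) (Z y)) := by
      ext y; simp
    have e2 : (fun y ↦ g.inner y (X y) ((f • Z) y)) = f * (fun y ↦ g.inner y (X y) (Z y)) := by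
      ext y; simp
    simp only [koszul, e1, e2, mvfderiv_mul hf (mdifferentiableAt_inner hY hZ),
      mvfderiv_mul hf (mdifferentiableAt_inner hX hZ), VectorField.mlieBracket_smul_right hf hZ]
    simp [g.symm x (Z x) _]
    ring
  add {Z Z'} hZ hZ' := by
    have e1 : (fun y ↦ g.inner y (Y y) ((Z + Z') y))
        = (fun y ↦ g.inner y (Y y) (Z y)) + (fun y ↦ g.inner y (Y y) (Z' y)) := by
      ext y; simp
    have e2 : (fun y ↦ g.inner y (X y) ((Z + Z') y))
        = (fun y ↦ g.inner y (X y) (Z y)) + (fun y ↦ g.inner y (X y) (Z' y)) := by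
      ext y; simp
    simp only [koszul, e1, e2,
      mvfderiv_add (mdifferentiableAt_inner hY hZ) (mdifferentiableAt_inner hY hZ'),
      mvfderiv_add (mdifferentiableAt_inner hX hZ) (mdifferentiableAt_inner hX hZ'),
      VectorField.mlieBracket_add_right hZ hZ']
    simp
    ring

variable [FiniteDimensional ℝ E]

/-- The covariant differential exists for every vector field that is differentiable at `x`. -/
theorem exists_isKoszulDerivAt (g : Metric E M) (hY : MDiffAt (T% Y) x) :
    ∃ L, IsKoszulDerivAt g Y x L := by
  have : CompleteSpace E := FiniteDimensional.complete ℝ E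
  have hfin : FiniteDimensional ℝ (TangentSpace 𝓘(ℝ, E) x) := inferInstanceAs (FiniteDimensional ℝ E)
  have ht2 : T2Space (TangentSpace 𝓘(ℝ, E) x) := inferInstanceAs (T2Space E)
  let B : TangentSpace 𝓘(ℝ, E) x →L[ℝ] TangentSpace 𝓘(ℝ, E) x →L[ℝ] ℝ :=
    TensorialAt.mkHom₂ (I := 𝓘(ℝ, E)) (F := E) (F' := E)
      (fun X Z : (Π x : M, TangentSpace 𝓘(ℝ, E) x) ↦ koszul g X Y Z x) x
      (fun Z hZ ↦ tensorialAt_koszul_left hY hZ) (fun X hX ↦ tensorialAt_koszul_right hX hY)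
  let b : TangentSpace 𝓘(ℝ, E) x →ₗ[ℝ] Module.Dual ℝ (TangentSpace 𝓘(ℝ, E) x) :=
    { toFun := fun v ↦ (g.inner x v).toLinearMap
      map_add' := fun v w ↦ by ext; simp
      map_smul' := fun c v ↦ by ext; simp }
  have hb : Function.Injective b := by
    rw [injective_iff_map_eq_zero]
    intro v hv
    by_contra hne
    exact (g.pos x v hne).ne' (LinearMap.congr_fun hv v)
  let e := LinearEquiv.ofInjectiveOfFinrankEq b hb (Subspace.dual_finrank_eq).symm
  let L : TangentSpace 𝓘(ℝ, E) x →ₗ[ℝ] TangentSpace 𝓘(ℝ, E) x :=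
    { toFun := fun v ↦ e.symm ((1 / 2 : ℝ) • (B v).toLinearMap)
      map_add' := fun v w ↦ by rw [← map_add]; congr 1; ext; simp
      map_smul' := fun c v ↦ by
        rw [RingHom.id_apply, ← map_smul]; congr 1; ext; simp; ring }
  refine ⟨LinearMap.toContinuousLinearMap L, fun X Z hX hZ ↦ ?_⟩
  have h1 : b (L (X x)) = (1 / 2 : ℝ) • (B (X x)).toLinearMap := e.apply_symm_apply _
  have h2 : g.inner x (L (X x)) (Z x) = (1 / 2 : ℝ) * B (X x) (Z x) := LinearMap.congr_fun h1 (Z x)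
  have h3 : B (X x) (Z x) = koszul g X Y Z x := TensorialAt.mkHom₂_apply _ _ hX hZ
  have h4 : 2 * g.inner x (L (X x)) (Z x) = koszul g X Y Z x := by rw [h2, h3]; ring
  exact h4

/-- The Koszul formula. -/
theorem leviCivita_koszul (g : Metric E M)
    (hX : MDiffAt (T% X) x) (hY : MDiffAt (T% Y) x) (hZ : MDiffAt (T% Z) x) :
    2 * g.inner x (leviCivita g Y x (X x)) (Z x) = koszul g X Y Z x := by
  have h := exists_isKoszulDerivAt g hY
  rw [leviCivita, dif_pos h]
  exact h.choose_spec X Z hX hZ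

/-- The Levi-Civita connection is compatible with the metric. -/
theorem leviCivita_metric (g : Metric E M)
    (hX : MDiffAt (T% X) x) (hY : MDiffAt (T% Y) x) (hZ : MDiffAt (T% Z) x) :
    mvfderiv 𝓘(ℝ, E) (fun y ↦ g.inner y (Y y) (Z y)) x (X x)
      = g.inner x (leviCivita g Y x (X x)) (Z x) + g.inner x (Y x) (leviCivita g Z x (X x)) := by
  have h1 := leviCivita_koszul g hX hY hZ
  have h2 := leviCivita_koszul g hX hZ hY
  have e : ∀ V W : Π x : M, TangentSpace 𝓘(ℝ, E) x,
      (fun y ↦ g.inner y (V y) (W y)) = fun y ↦ g.inner y (W y) (V y) :=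
    fun V W ↦ funext fun y ↦ g.symm y _ _
  rw [koszul, e X Z, VectorField.mlieBracket_swap_apply (V := Y)] at h1
  rw [koszul, e Z Y, e X Z] at h2
  rw [g.symm x (Y x)]
  simp only [map_neg, neg_apply] at h1
  linarith

/-- The Levi-Civita connection is torsion-free. -/
theorem leviCivita_torsion (g : Metric E M) (hX : MDiffAt (T% X) x) (hY : MDiffAt (T% Y) x) :
    leviCivita g Y x (X x) - leviCivita g X x (Y x) = VectorField.mlieBracket 𝓘(ℝ, E) X Y x := by
  have key : ∀ Z : Π x : M, TangentSpace 𝓘(ℝ, E) x, MDiffAt (T% Z) x →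
      g.inner x (leviCivita g Y x (X x) - leviCivita g X x (Y x)
        - VectorField.mlieBracket 𝓘(ℝ, E) X Y x) (Z x) = 0 := by
    intro Z hZ
    have h1 := leviCivita_koszul g hX hY hZ
    have h2 := leviCivita_koszul g hY hX hZ
    have e : ∀ V W : Π x : M, TangentSpace 𝓘(ℝ, E) x,
        (fun y ↦ g.inner y (V y) (W y)) = fun y ↦ g.inner y (W y) (V y) :=
      fun V W ↦ funext fun y ↦ g.symm y _ _
    rw [koszul] at h1
    rw [koszul, e Y X, VectorField.mlieBracket_swap_apply (V := Y) (W := X)] at h2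
    simp only [map_neg, neg_apply] at h2
    simp only [map_sub, sub_apply]
    linarith
  by_contra hne
  have hne' := sub_ne_zero.mpr hne
  have h := key (FiberBundle.extend E (leviCivita g Y x (X x) - leviCivita g X x (Y x)
        - VectorField.mlieBracket 𝓘(ℝ, E) X Y x)) (FiberBundle.mdifferentiableAt_extend ..)
  rw [FiberBundle.extend_apply_self] at h
  exact (g.pos x _ hne').ne' h

end Koszul

/-- `nablaEnd g A Y x v` is `(∇_v A) Y = ∇_v (A Y) - A (∇_v Y)` at `x`, for a `(1,1)`-tensor field
`A`, a vector field `Y` and a tangent vector `v` at `x`. -/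
def nablaEnd (g : Metric E M)
    (A : Π x : M, TangentSpace 𝓘(ℝ, E) x →L[ℝ] TangentSpace 𝓘(ℝ, E) x)
    (Y : Π x : M, TangentSpace 𝓘(ℝ, E) x) (x : M) (v : TangentSpace 𝓘(ℝ, E) x) :
    TangentSpace 𝓘(ℝ, E) x :=
  leviCivita g (fun y ↦ A y (Y y)) x v - A x (leviCivita g Y x v)

/-! ### Kenmotsu and 3-Kenmotsu structures -/

/-- `(φ, ξ, η, g)` is an almost contact metric structure on `M`. -/
structure IsAlmostContactMetric (g : Metric E M)
    (φ : Π x : M, TangentSpace 𝓘(ℝ, E) x →L[ℝ] TangentSpace 𝓘(ℝ, E) x)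
    (ξ : Π x : M, TangentSpace 𝓘(ℝ, E) x)
    (η : Π x : M, TangentSpace 𝓘(ℝ, E) x →L[ℝ] ℝ) : Prop where
  smooth_phi : SmoothEnd φ univ
  smooth_xi : SmoothField ξ univ
  smooth_eta : SmoothForm η univ
  /-- `η` is dual to `ξ` with respect to `g`. -/
  eta_dual : ∀ x v, η x v = g.inner x (ξ x) v
  phi_sq : ∀ x v, φ x (φ x v) = -v + η x v • ξ x
  eta_xi : ∀ x, η x (ξ x) = 1
  eta_phi : ∀ x v, η x (φ x v) = 0
  phi_xi : ∀ x, φ x (ξ x) = 0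
  metric_phi : ∀ x v w, g.inner x (φ x v) (φ x w) = g.inner x v w - η x v * η x w

/-- `(φ, ξ, η, g)` is a Kenmotsu structure on `M`: an almost contact metric structure with
`(∇_X φ) Y = g(φ X, Y) ξ - η(Y) φ X`. -/
structure IsKenmotsu (g : Metric E M)
    (φ : Π x : M, TangentSpace 𝓘(ℝ, E) x →L[ℝ] TangentSpace 𝓘(ℝ, E) x)
    (ξ : Π x : M, TangentSpace 𝓘(ℝ, E) x)
    (η : Π x : M, TangentSpace 𝓘(ℝ, E) x →L[ℝ] ℝ) : Prop
    extends IsAlmostContactMetric g φ ξ η where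
  nabla_phi : ∀ (x : M) (v : TangentSpace 𝓘(ℝ, E) x) (Y : Π x : M, TangentSpace 𝓘(ℝ, E) x),
    MDiffAt (T% Y) x →
      nablaEnd g φ Y x v = g.inner x (φ x v) (Y x) • ξ x - η x (Y x) • φ x v

/-- `(φ₀, φ₁, φ₂, ξ, η, g)` is a 3-Kenmotsu structure on `M`: three Kenmotsu structures with common
`ξ`, `η`, `g`, such that `φ_k = φ_i ∘ φ_j` for all even permutations `(i, j, k)` of the indices
(indices in `Fin 3` are added modulo `3`). -/
structure IsThreeKenmotsu (g : Metric E M)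
    (φ : Fin 3 → Π x : M, TangentSpace 𝓘(ℝ, E) x →L[ℝ] TangentSpace 𝓘(ℝ, E) x)
    (ξ : Π x : M, TangentSpace 𝓘(ℝ, E) x)
    (η : Π x : M, TangentSpace 𝓘(ℝ, E) x →L[ℝ] ℝ) : Prop where
  kenmotsu : ∀ i, IsKenmotsu g (φ i) ξ η
  comp : ∀ i x v, φ (i + 2) x v = φ i x (φ (i + 1) x v)

/-! ### Quaternion Kähler manifolds -/

/-- At the point `x`, the three endomorphisms `J i` satisfy the quaternion relations
and are orthogonal for `g`. -/
structure IsHermitianQuaternionTriple (g : Metric E M) (x : M)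
    (J : Fin 3 → TangentSpace 𝓘(ℝ, E) x →L[ℝ] TangentSpace 𝓘(ℝ, E) x) : Prop where
  sq : ∀ i v, J i (J i v) = -v
  comp : ∀ i v, J i (J (i + 1) v) = J (i + 2) v
  anticomp : ∀ i v, J (i + 1) (J i v) = -J (i + 2) v
  metric : ∀ i v w, g.inner x (J i v) (J i w) = g.inner x v w

/-- `(M, g)` is a quaternion Kähler manifold: there is a subbundle `Q` of `End(TM)` which locally
has a smooth basis `J₀, J₁, J₂` of almost Hermitian structures satisfying the quaternion relations,
and which is parallel, i.e. the covariant derivative of every local smooth section of `Q` in every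
direction is again in `Q`. (The quaternion relations make `J₀, J₁, J₂` linearly independent as soon
as the tangent spaces are nonzero.) -/
def IsQuaternionKahler (g : Metric E M) : Prop :=
  ∃ Q : Π x : M, Submodule ℝ (TangentSpace 𝓘(ℝ, E) x →L[ℝ] TangentSpace 𝓘(ℝ, E) x),
    (∀ x₀ : M, ∃ U : Set M, IsOpen U ∧ x₀ ∈ U ∧
      ∃ J : Fin 3 → Π x : M, TangentSpace 𝓘(ℝ, E) x →L[ℝ] TangentSpace 𝓘(ℝ, E) x,
        (∀ i, SmoothEnd (J i) U) ∧
        ∀ x ∈ U, IsHermitianQuaternionTriple g x (fun i ↦ J i x) ∧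
          Q x = Submodule.span ℝ (range fun i ↦ J i x)) ∧
    ∀ (U : Set M) (A : Π x : M, TangentSpace 𝓘(ℝ, E) x →L[ℝ] TangentSpace 𝓘(ℝ, E) x),
      IsOpen U → SmoothEnd A U → (∀ x ∈ U, A x ∈ Q x) →
      ∀ x ∈ U, ∀ v : TangentSpace 𝓘(ℝ, E) x, ∃ B ∈ Q x,
        ∀ Y : Π x : M, TangentSpace 𝓘(ℝ, E) x, MDiffAt (T% Y) x → nablaEnd g A Y x v = B (Y x)

end

/-! ### Warped products -/

section

variable {F : Type*} [NormedAddCommGroup F] [NormedSpace ℝ F]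
  {V : Type*} [TopologicalSpace V] [ChartedSpace F V] [IsManifold 𝓘(ℝ, F) ∞ V]

/-- The warped product metric `dt² + f(t)² h` at the point `q = (t, v)` of `ℝ × V`, on tangent
vectors `a = (a.1, a.2)` and `b = (b.1, b.2)`, where `h` is a Riemannian metric on `V`. -/
def warpedInner (f : ℝ → ℝ) (h : Metric F V) (q : ℝ × V)
    (a b : TangentSpace (𝓘(ℝ, ℝ).prod 𝓘(ℝ, F)) q) : ℝ :=
  a.1 * b.1 + f q.1 ^ 2 * h.inner q.2 a.2 b.2

end

end ThreeKenmotsu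

end

/-!
On a Kenmotsu manifold the identity for `∇φ`, evaluated on `ξ`, gives `∇_v ξ = v - η(v) ξ`
(`IsKenmotsu.leviCivita_xi`). Hence `η` is closed (`IsKenmotsu.mvfderiv_eta_sub`), the Lie
derivative of `g` along `ξ` is `2 (g - η ⊗ η)` (`IsKenmotsu.mvfderiv_inner_xi`), and the flow of
`ξ` preserves `φ` (`IsKenmotsu.mlieBracket_xi_phi`).

A local primitive `f` of `η` satisfies `ξ f = 1`. Flowing along `ξ` from the points of a hyperplane
transverse to `ξ`, for the time `t - f` after which the value of `f` is `t`, yields coordinates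
`(t, v)` in `(-ε, ε) × F`, with `F` a Euclidean space, in which `ξ = ∂/∂t` and `η = dt`
(`exists_isAdapted`). This uses that the flow of a smooth vector field is smooth in time and
initial condition, which is obtained by applying the inverse function theorem in the Banach space
of curves to the integral equation (`exists_contDiffOn_flow`). In these coordinates the
differential equation for `g` integrates to `g = dt² + e^{2t} h`, where `h` is the metric of the
leaf `{t = 0}` (`IsAdapted.pullMetric_eq`, `IsAdapted.inner_differential`), and `φ` does not depend
on `t` (`IsAdapted.pullEnd_eq`).

The three structure tensors induce endomorphism fields `J₀, J₁, J₂` of the leaf, which satisfy the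
quaternion relations and are orthogonal. By the Gauss formula
(`IsAdapted.inner_leviCivita_leafMetric`), the Levi-Civita connection of `h` is the tangential part
of that of `g`, and on fields tangent to the leaves `∇φ` has only normal values; so every `Jᵢ` is
parallel (`IsAdapted.nablaEnd_leafEnd`), and the leaf is quaternion Kähler
(`isQuaternionKahler_of_parallel`). Its dimension is a multiple of four because the kernel of `η`
at a point is a vector space over the quaternions (`four_dvd_finrank`).
-/

noncomputable section

namespace ThreeKenmotsu

/-! ### Smooth dependence of integral curves on the initial value -/

section Flow

open ContinuousMap

/-- A continuously differentiable map with invertible derivative at a point restricts to a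
diffeomorphism between open sets, inside any open set `O` on which it is smooth. -/
theorem exists_openPartialHomeomorph_contDiffOn {E F : Type*} [NormedAddCommGroup E]
    [NormedSpace ℝ E] [NormedAddCommGroup F] [NormedSpace ℝ F] [CompleteSpace E]
    {f : E → F} {O : Set E} (hO : IsOpen O) {a : E} (ha : a ∈ O) (hf : ContDiffOn ℝ ∞ f O)
    {f' : E ≃L[ℝ] F} (hf' : HasFDerivAt f (f' : E →L[ℝ] F) a) :
    ∃ e : OpenPartialHomeomorph E F, a ∈ e.source ∧ e.source ⊆ O ∧ (∀ x, e x = f x) ∧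
      ContDiffOn ℝ ∞ e e.source ∧ ContDiffOn ℝ ∞ e.symm e.target := by
  have hfa : ContDiffAt ℝ ∞ f a := hf.contDiffAt (hO.mem_nhds ha)
  let e₀ := hfa.toOpenPartialHomeomorph f hf' (by simp)
  have hcont : ContinuousOn (fderiv ℝ f) O := hf.continuousOn_fderiv_of_isOpen hO (by simp)
  have hW : IsOpen (O ∩ fderiv ℝ f ⁻¹' range ((↑) : (E ≃L[ℝ] F) → E →L[ℝ] F)) :=
    hcont.isOpen_inter_preimage hO ContinuousLinearEquiv.isOpen
  let e := e₀.restrOpen _ hW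
  have hsub : e.source ⊆ O := fun x hx ↦ hx.2.1
  have hfun : ∀ x, e x = f x := fun x ↦ rfl
  refine ⟨e, ⟨hfa.mem_toOpenPartialHomeomorph_source hf' _, ha, ?_⟩, hsub, hfun, ?_, ?_⟩
  · exact ⟨f', hf'.fderiv.symm⟩
  · exact hf.mono hsub
  · intro y hy
    have hx : e.symm y ∈ e.source := e.map_target hy
    obtain ⟨L, hL⟩ := hx.2.2
    have h1 : ContDiffAt ℝ ∞ f (e.symm y) := hf.contDiffAt (hO.mem_nhds (hsub hx))
    have h2 : HasFDerivAt f (L : E →L[ℝ] F) (e.symm y) := by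
      rw [hL]; exact (h1.differentiableAt (by simp)).hasFDerivAt
    exact (e.contDiffAt_symm hy h2 h1).contDiffWithinAt

variable {K : Type*} [TopologicalSpace K] [CompactSpace K]

/-- Pointwise application of a continuous bilinear map to pairs of curves, as a continuous bilinear
map. -/
def pointwiseBilin (K : Type*) [TopologicalSpace K] [CompactSpace K]
    {G E F : Type*} [NormedAddCommGroup G] [NormedSpace ℝ G] [NormedAddCommGroup E]
    [NormedSpace ℝ E] [NormedAddCommGroup F] [NormedSpace ℝ F] (B : G →L[ℝ] E →L[ℝ] F) :
    C(K, G) →L[ℝ] C(K, E) →L[ℝ] C(K, F) :=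
  LinearMap.mkContinuous₂
    (LinearMap.mk₂ ℝ (fun (T : C(K, G)) (u : C(K, E)) ↦ (⟨fun t ↦ B (T t) (u t), by fun_prop⟩ : C(K, F)))
      (fun _ _ _ ↦ by ext; simp) (fun _ _ _ ↦ by ext; simp)
      (fun _ _ _ ↦ by ext; simp) (fun _ _ _ ↦ by ext; simp)) ‖B‖ (fun T u ↦ by
      rw [ContinuousMap.norm_le _ (by positivity)]
      exact fun t ↦ (B.le_opNorm₂ _ _).trans (by
        gcongr
        · exact T.norm_coe_le_norm t
        · exact u.norm_coe_le_norm t))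

variable {E : Type*} [NormedAddCommGroup E] [NormedSpace ℝ E]

/-- The derivative of the superposition operator `u ↦ f ∘ u` is `h ↦ (Df ∘ u) h`. The uniform
estimate follows from the continuity of `u ↦ Df ∘ u`. -/
theorem hasFDerivAt_comp {F G : Type*} [NormedAddCommGroup F] [NormedSpace ℝ F]
    [NormedAddCommGroup G] [NormedSpace ℝ G] (B : G →L[ℝ] E →L[ℝ] F)
    (f : C(E, F)) (f' : C(E, G)) (hf : ∀ x, HasFDerivAt f (B (f' x)) x) (u : C(K, E)) :
    HasFDerivAt (fun u : C(K, E) ↦ f.comp u) (pointwiseBilin K B (f'.comp u)) u := by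
  rw [hasFDerivAt_iff_isLittleO_nhds_zero, Asymptotics.isLittleO_iff]
  intro ε hε
  have hε' : 0 < ε / (‖B‖ + 1) := by positivity
  have hc := f'.continuous_postcomp (X := K) |>.continuousAt (x := u)
  obtain ⟨δ, hδ, hd⟩ := Metric.continuousAt_iff.1 hc _ hε'
  filter_upwards [Metric.ball_mem_nhds (0 : C(K, E)) hδ] with h hh
  rw [mem_ball_zero_iff] at hh
  rw [ContinuousMap.norm_le _ (by positivity)]
  intro t
  have hht : ‖h t‖ < δ := (h.norm_coe_le_norm t).trans_lt hh
  have key : ‖f (u t + h t) - f (u t) - B (f' (u t)) (u t + h t - u t)‖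
      ≤ ε * ‖u t + h t - u t‖ := by
    refine (convex_ball (u t) δ).norm_image_sub_le_of_norm_hasFDerivWithin_le'
      (fun z _ ↦ (hf z).hasFDerivWithinAt)
      (fun z hz ↦ ?_) (Metric.mem_ball_self hδ) (by simpa [Metric.mem_ball, dist_eq_norm] using hht)
    -- translating `u` by the constant `z - u t` reduces the bound at `z` to uniform closeness
    have h1 : dist (u + ContinuousMap.const K (z - u t)) u < δ := by
      rw [dist_eq_norm, add_sub_cancel_left]
      refine (ContinuousMap.norm_lt_iff _ hδ).2 fun s ↦ ?_
      simpa [dist_eq_norm] using hz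
    have h2 := (ContinuousMap.dist_lt_iff hε').1 (hd h1) t
    simp only [ContinuousMap.comp_apply, ContinuousMap.add_apply, ContinuousMap.const_apply,
      add_sub_cancel, dist_eq_norm] at h2
    rw [← map_sub]
    refine (B.le_opNorm _).trans ((mul_le_mul_of_nonneg_left h2.le (norm_nonneg _)).trans ?_)
    rw [← mul_div_assoc, div_le_iff₀ (by positivity)]
    nlinarith [norm_nonneg B]
  have hval : (f.comp (u + h) - f.comp u - pointwiseBilin K B (f'.comp u) h) t
      = f (u t + h t) - f (u t) - B (f' (u t)) (h t) := rfl
  rw [add_sub_cancel_left] at key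
  rw [hval]
  exact key.trans (mul_le_mul_of_nonneg_left (h.norm_coe_le_norm t) hε.le)

theorem contDiff_succ_comp {F G : Type*} [NormedAddCommGroup F] [NormedSpace ℝ F]
    [NormedAddCommGroup G] [NormedSpace ℝ G] (B : G →L[ℝ] E →L[ℝ] F)
    (f : C(E, F)) (f' : C(E, G)) (hf : ∀ x, HasFDerivAt f (B (f' x)) x) (n : ℕ)
    (h : ContDiff ℝ n (fun u : C(K, E) ↦ f'.comp u)) :
    ContDiff ℝ (n + 1) (fun u : C(K, E) ↦ f.comp u) :=
  contDiff_succ_iff_hasFDerivAt.2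
    ⟨_, (ContinuousLinearMap.contDiff _).comp h, fun u ↦ hasFDerivAt_comp B f f' hf u⟩

universe w

/-- The superposition operator `u ↦ f ∘ u` of a smooth map `f` is smooth on spaces of continuous
maps. The two spaces lie in the same universe because the induction passes from `F` to
`E →L[ℝ] F`. -/
theorem contDiff_comp {E F : Type w} [NormedAddCommGroup E] [NormedSpace ℝ E]
    [NormedAddCommGroup F] [NormedSpace ℝ F] (f : C(E, F)) (hf : ContDiff ℝ ∞ f) :
    ContDiff ℝ ∞ (fun u : C(K, E) ↦ f.comp u) := by
  rw [contDiff_infty]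
  intro n
  induction n generalizing F with
  | zero => exact contDiff_zero.2 (ContinuousMap.continuous_postcomp _)
  | succ n ih =>
    have hf' : ContDiff ℝ ∞ (fderiv ℝ f) := hf.fderiv_right (by simp)
    exact contDiff_succ_comp (.id ℝ _) f ⟨fderiv ℝ f, hf'.continuous⟩
      (fun x ↦ (hf.differentiable (by simp) x).hasFDerivAt) n (ih _ hf')

/-- The operator `u ↦ (t ↦ ∫ τ in 0..t, u τ)` on continuous curves defined on the unit interval. -/
def integralOperator (E : Type*) [NormedAddCommGroup E] [NormedSpace ℝ E] :
    C(unitInterval, E) →L[ℝ] C(unitInterval, E) :=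
  LinearMap.mkContinuous
    { toFun u := ⟨fun t ↦ ∫ τ in (0 : ℝ)..t, u (projIcc 0 1 zero_le_one τ),
        (intervalIntegral.continuous_primitive (fun a b ↦
          (u.continuous.comp continuous_projIcc).intervalIntegrable a b) 0).comp
          continuous_subtype_val⟩
      map_add' u v := by
        ext t
        exact intervalIntegral.integral_add
          ((u.continuous.comp continuous_projIcc).intervalIntegrable _ _)
          ((v.continuous.comp continuous_projIcc).intervalIntegrable _ _)
      map_smul' c u := by
        ext t
        exact intervalIntegral.integral_smul _ _ } 1 (fun u ↦ by
    rw [one_mul, ContinuousMap.norm_le _ (norm_nonneg _)]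
    intro t
    have h := intervalIntegral.norm_integral_le_of_norm_le_const
      (f := fun τ ↦ u (projIcc 0 1 zero_le_one τ)) (a := 0) (b := t) (C := ‖u‖)
      (fun τ _ ↦ u.norm_coe_le_norm _)
    refine h.trans ?_
    rw [sub_zero, abs_of_nonneg t.2.1]
    exact mul_le_of_le_one_right (norm_nonneg _) t.2.2)

theorem integralOperator_apply (u : C(unitInterval, E)) (t : unitInterval) :
    integralOperator E u t = ∫ τ in (0 : ℝ)..t, u (projIcc 0 1 zero_le_one τ) := rfl

variable [FiniteDimensional ℝ E]

/-- A solution of the integral equation `u(t) = x + s ∫₀ᵗ X(u)` ends at the value at time `s`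
of the integral curve of `X` starting at `x`. -/
theorem eq_integralCurve_of_integral_eq {X : E → E} {k : NNReal} (hX : LipschitzWith k X) {x : E}
    {s : ℝ} {u : C(unitInterval, E)}
    (hu : u = ContinuousMap.const _ x
      + s • integralOperator E ((⟨X, hX.continuous⟩ : C(E, E)).comp u))
    {γ : ℝ → E} (h0 : γ 0 = x) (hγ : ∀ t ∈ uIcc 0 s, HasDerivAt γ (X (γ t)) t) :
    u 1 = γ s := by
  have : CompleteSpace E := FiniteDimensional.complete ℝ E
  let U : ℝ → E := fun t ↦ u (projIcc 0 1 zero_le_one t)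
  have hU : Continuous U := u.continuous.comp continuous_projIcc
  let V : ℝ → E := fun t ↦ x + s • ∫ τ in (0 : ℝ)..t, X (U τ)
  have hV : ∀ t, HasDerivAt V (s • X (U t)) t := fun t ↦
    (((hX.continuous.comp hU).integral_hasStrictDerivAt 0 t).hasDerivAt.const_smul s).const_add x
  have hVu : ∀ t : unitInterval, V t = u t := by
    intro t
    conv_rhs => rw [hu]
    simp [V, U, integralOperator_apply]
  have hVU : ∀ t ∈ Icc (0 : ℝ) 1, U t = V t := by
    intro t ht
    simp only [U]
    rw [projIcc_of_mem _ ht, ← hVu]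
  have hs : ∀ t ∈ Icc (0 : ℝ) 1, s * t ∈ uIcc 0 s := by
    rintro t ⟨h1, h2⟩
    rcases le_total 0 s with h | h
    · rw [uIcc_of_le h]; constructor <;> nlinarith
    · rw [uIcc_of_ge h]; constructor <;> nlinarith
  have hg : ∀ t ∈ Icc (0 : ℝ) 1, HasDerivAt (fun t ↦ γ (s * t)) (s • X (γ (s * t))) t := by
    intro t ht
    have h1 : HasDerivAt (fun t : ℝ ↦ s * t) s t := by simpa using (hasDerivAt_id t).const_mul s
    exact (hγ _ (hs t ht)).scomp t h1
  have key := ODE_solution_unique (v := fun _ y ↦ s • X y) (K := ‖s‖₊ * k) (f := V)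
    (g := fun t ↦ γ (s * t)) (a := 0) (b := 1) (fun t ↦ by
      exact (lipschitzWith_smul s).comp hX)
    (fun t _ ↦ (hV t).continuousAt.continuousWithinAt)
    (fun t ht ↦ by rw [← hVU t ⟨ht.1, ht.2.le⟩]; exact (hV t).hasDerivWithinAt)
    (fun t ht ↦ (hg t ht).continuousAt.continuousWithinAt)
    (fun t ht ↦ (hg t ⟨ht.1, ht.2.le⟩).hasDerivWithinAt) (by simp [V, h0])
  have := key (right_mem_Icc.2 zero_le_one)
  rw [← hVu 1]
  simpa using this

/-- The local flow of a compactly supported smooth vector field is smooth. It is obtained by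
applying the inverse function theorem, in the space of continuous curves on the unit interval, to
the integral equation `u(t) = x + s ∫₀ᵗ X(u)`, in which the time `s` is a parameter: at `s = 0` the
linearization is the identity. -/
theorem exists_contDiffOn_flow {X : E → E} (hX : ContDiff ℝ ∞ X) (hc : HasCompactSupport X)
    (x₀ : E) : ∃ (A : ℝ × E → E) (O : Set (ℝ × E)), IsOpen O ∧ ((0 : ℝ), x₀) ∈ O ∧
      ContDiffOn ℝ ∞ A O ∧ (∀ x, ((0 : ℝ), x) ∈ O → A (0, x) = x) ∧
      ∀ q ∈ O, HasDerivAt (fun t ↦ A (t, q.2)) (X (A q)) q.1 := by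
  have : CompleteSpace E := FiniteDimensional.complete ℝ E
  obtain ⟨k, hk⟩ := hX.lipschitzWith_of_hasCompactSupport hc (by simp)
  let N : C(unitInterval, E) → C(unitInterval, E) := fun u ↦
    integralOperator E ((⟨X, hX.continuous⟩ : C(E, E)).comp u)
  have hN : ContDiff ℝ ∞ N := (integralOperator E).contDiff.comp (contDiff_comp _ hX)
  let constL : E →L[ℝ] C(unitInterval, E) := ContinuousLinearMap.const ℝ unitInterval
  let H : (ℝ × E) × C(unitInterval, E) → (ℝ × E) × C(unitInterval, E) :=
    fun q ↦ (q.1, q.2 - constL q.1.2 - q.1.1 • N q.2)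
  have hH : ContDiff ℝ ∞ H := by
    have := hN.comp (contDiff_snd (E := ℝ × E) (F := C(unitInterval, E)))
    have h2 : ContDiff ℝ ∞ (fun q : (ℝ × E) × C(unitInterval, E) ↦ N q.2) := this
    have h3 := constL.contDiff (n := ∞)
    fun_prop
  let u₀ := constL x₀
  let a : (ℝ × E) × C(unitInterval, E) := ((0, x₀), u₀)
  let B : ℝ × E →L[ℝ] C(unitInterval, E) :=
    constL.comp (ContinuousLinearMap.snd ℝ ℝ E)
      + (ContinuousLinearMap.fst ℝ ℝ E).smulRight (N u₀)
  let f' : ((ℝ × E) × C(unitInterval, E)) ≃L[ℝ] ((ℝ × E) × C(unitInterval, E)) :=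
    ContinuousLinearEquiv.equivOfInverse
      ((ContinuousLinearMap.fst ℝ _ _).prod (ContinuousLinearMap.snd ℝ _ _
        - B.comp (ContinuousLinearMap.fst ℝ _ _)))
      ((ContinuousLinearMap.fst ℝ _ _).prod (ContinuousLinearMap.snd ℝ _ _
        + B.comp (ContinuousLinearMap.fst ℝ _ _)))
      (fun q ↦ by simp) (fun q ↦ by simp)
  have hf' : HasFDerivAt H (f' : _ →L[ℝ] _) a := by
    have hNa : HasFDerivAt (fun q : (ℝ × E) × C(unitInterval, E) ↦ N q.2) _ a :=
      HasFDerivAt.comp (g := N) a (hN.differentiable (by simp) u₀).hasFDerivAt hasFDerivAt_snd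
    have hp : HasFDerivAt (fun q : (ℝ × E) × C(unitInterval, E) ↦ q.1)
      (ContinuousLinearMap.fst ℝ (ℝ × E) C(unitInterval, E)) a := hasFDerivAt_fst
    have h1 : HasFDerivAt (fun q : (ℝ × E) × C(unitInterval, E) ↦ q.1.1 • N q.2) _ a :=
      hp.fst.fun_smul hNa
    have h2 : HasFDerivAt (fun q : (ℝ × E) × C(unitInterval, E) ↦ constL q.1.2) _ a :=
      constL.hasFDerivAt.comp a hp.snd
    have h3 : HasFDerivAt H _ a :=
      hasFDerivAt_fst.prodMk ((hasFDerivAt_snd.sub h2).sub h1)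
    convert! h3 using 1
    ext q <;> simp [f', B, a, u₀]
  obtain ⟨e, hae, -, hef, -, hes⟩ := exists_openPartialHomeomorph_contDiffOn isOpen_univ
    (mem_univ a) hH.contDiffOn hf'
  have hHa : H a = ((0, x₀), 0) := by simp [H, a, u₀]
  let ι : ℝ × E → (ℝ × E) × C(unitInterval, E) := fun p ↦ (p, 0)
  have hι : ContDiff ℝ ∞ ι := contDiff_id.prodMk contDiff_const
  let u : ℝ × E → C(unitInterval, E) := fun p ↦ (e.symm (ι p)).2
  have hu : ∀ p, ι p ∈ e.target → u p = ContinuousMap.const _ p.2 + p.1 • N (u p) := by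
    intro p hp
    have h1 : H (e.symm (ι p)) = ι p := by rw [← hef]; exact e.right_inv hp
    have h2 : (e.symm (ι p)).1 = p := congrArg Prod.fst h1
    have h3 : (e.symm (ι p)).2 - constL (e.symm (ι p)).1.2
      - (e.symm (ι p)).1.1 • N (e.symm (ι p)).2 = 0 := congrArg Prod.snd h1
    rw [h2, sub_sub, sub_eq_zero] at h3
    exact h3
  let A : ℝ × E → E := fun p ↦ u p 1
  obtain ⟨α, hα⟩ := (hX.contDiffAt (x := x₀)).of_le (m := 1) (by simp)
    |>.exists_eventually_eq_hasDerivAt 0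
  obtain ⟨s₁, hs₁, s₂, hs₂, hαs⟩ := Filter.eventually_prod_iff.1 hα
  obtain ⟨r, hr, hrs⟩ := Metric.eventually_nhds_iff_ball.1 hs₁
  obtain ⟨ε, hε, hεs⟩ := Metric.eventually_nhds_iff_ball.1 hs₂
  let O : Set (ℝ × E) := ι ⁻¹' e.target ∩ Metric.ball (0 : ℝ) ε ×ˢ Metric.ball x₀ r
  have hO : IsOpen O := (e.open_target.preimage hι.continuous).inter
    (Metric.isOpen_ball.prod Metric.isOpen_ball)
  have hA : ∀ p ∈ O, A p = α p.2 p.1 := by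
    rintro p ⟨hp, hp1, hp2⟩
    have hb : ∀ t ∈ uIcc 0 p.1, t ∈ Metric.ball (0 : ℝ) ε := fun t ht ↦
      (convex_ball (0 : ℝ) ε).ordConnected.uIcc_subset (Metric.mem_ball_self hε) hp1 ht
    refine eq_integralCurve_of_integral_eq hk (hu p hp) ?_ fun t ht ↦ ?_
    · exact (hαs (hrs _ hp2) (hεs _ (Metric.mem_ball_self hε))).1
    · exact (hαs (hrs _ hp2) (hεs _ (hb t ht))).2
  refine ⟨A, O, hO, ⟨?_, ?_⟩, ?_, ?_, ?_⟩
  · have := e.map_source hae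
    rwa [hef, hHa] at this
  · exact ⟨Metric.mem_ball_self hε, Metric.mem_ball_self hr⟩
  · have h1 : ContDiffOn ℝ ∞ u O :=
      (hes.comp hι.contDiffOn (fun p hp ↦ hp.1)).snd
    exact (ContinuousMap.evalCLM ℝ (1 : unitInterval)).contDiff.comp_contDiffOn h1
  · intro x hx
    rw [hA _ hx]
    exact (hαs (hrs _ hx.2.2) (hεs _ (Metric.mem_ball_self hε))).1
  · rintro q hq
    have h1 : HasDerivAt (α q.2) (X (α q.2 q.1)) q.1 := (hαs (hrs _ hq.2.2) (hεs _ hq.2.1)).2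
    rw [hA q hq]
    refine h1.congr_of_eventuallyEq ?_
    have hev : ∀ᶠ t in 𝓝 q.1, (t, q.2) ∈ O :=
      (Continuous.prodMk_left q.2).continuousAt.eventually (hO.mem_nhds hq)
    filter_upwards [hev] with t ht
    exact hA _ ht

end Flow

/-! ### Straightening a vector field and a function growing along it -/

section FlowBox

variable {E : Type*} [NormedAddCommGroup E] [NormedSpace ℝ E] [FiniteDimensional ℝ E]

/-- A vector field that is smooth near a point agrees near this point with a smooth vector field of
compact support. -/
theorem exists_contDiff_hasCompactSupport_eqOn {O : Set E} (hO : IsOpen O) {x₀ : E} (hx₀ : x₀ ∈ O)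
    {X : E → E} (hX : ContDiffOn ℝ ∞ X O) :
    ∃ Y : E → E, ContDiff ℝ ∞ Y ∧ HasCompactSupport Y ∧
      ∃ r > 0, Metric.ball x₀ r ⊆ O ∧ EqOn Y X (Metric.ball x₀ r) := by
  obtain ⟨R, hR, hRO⟩ := Metric.nhds_basis_closedBall.mem_iff.1 (hO.mem_nhds hx₀)
  let χ : ContDiffBump x₀ := ⟨R / 2, R, by positivity, by linarith⟩
  refine ⟨fun y ↦ χ y • X y, ?_, χ.hasCompactSupport.smul_right, R / 2, by positivity,
    (Metric.ball_subset_closedBall.trans (Metric.closedBall_subset_closedBall (by linarith))).trans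
      hRO, fun y hy ↦ ?_⟩
  · rw [contDiff_iff_contDiffAt]
    intro y
    by_cases hy : y ∈ O
    · exact χ.contDiff.contDiffAt.smul (hX.contDiffAt (hO.mem_nhds hy))
    · have hy' : y ∉ tsupport χ := by rw [χ.tsupport_eq]; exact fun h ↦ hy (hRO h)
      have : (fun y ↦ χ y • X y) =ᶠ[𝓝 y] fun _ ↦ 0 := by
        filter_upwards [notMem_tsupport_iff_eventuallyEq.1 hy'] with z hz
        simp [hz]
      exact contDiffAt_const.congr_of_eventuallyEq this
  · have : χ y = 1 := χ.one_of_mem_closedBall (Metric.ball_subset_closedBall hy)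
    simp [this]

/-- If the vector field `X` and the function `f` satisfy `X f = 1`, there are local coordinates
`(t, v)` in which `X = ∂/∂t` and `f = t`. Flowing along `X` from the points `y₀ + κ v` of an affine
hyperplane straightens `X`; replacing the flow time `t` by `t - f (y₀ + κ v)` makes the slices
`t = const` the level sets of `f`. -/
theorem exists_flowBox {F : Type*} [NormedAddCommGroup F] [InnerProductSpace ℝ F]
    [FiniteDimensional ℝ F] {O : Set E} (hO : IsOpen O) {y₀ : E} (hy₀ : y₀ ∈ O)
    {X : E → E} (hX : ContDiffOn ℝ ∞ X O) {f : E → ℝ} (hf : ContDiffOn ℝ ∞ f O) (hf₀ : f y₀ = 0)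
    (hfX : ∀ y ∈ O, fderiv ℝ f y (X y) = 1) {κ : F →L[ℝ] E}
    (hκ : ∀ w, fderiv ℝ f y₀ (κ w) = 0) (L : (ℝ × F) ≃L[ℝ] E)
    (hL : ∀ s w, L (s, w) = s • X y₀ + κ w) :
    ∃ (ε : ℝ) (Ψ : OpenPartialHomeomorph (ℝ × F) E), 0 < ε ∧
      Ψ.source = Ioo (-ε) ε ×ˢ univ ∧ Ψ.target ⊆ O ∧ y₀ ∈ Ψ.target ∧
      ContDiffOn ℝ ∞ Ψ Ψ.source ∧ ContDiffOn ℝ ∞ Ψ.symm Ψ.target ∧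
      (∀ q ∈ Ψ.source, HasDerivAt (fun t ↦ Ψ (t, q.2)) (X (Ψ q)) q.1) ∧
      ∀ q ∈ Ψ.source, f (Ψ q) = q.1 := by
  obtain ⟨Y, hY, hYc, r, hr, hrO, hYX⟩ := exists_contDiff_hasCompactSupport_eqOn hO hy₀ hX
  obtain ⟨A, O₁, hO₁, h0O₁, hA, hA0, hAd⟩ := exists_contDiffOn_flow hY hYc y₀
  have hW : IsOpen (O₁ ∩ A ⁻¹' Metric.ball y₀ r) :=
    hA.continuousOn.isOpen_inter_preimage hO₁ Metric.isOpen_ball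
  have h0W : ((0 : ℝ), y₀) ∈ O₁ ∩ A ⁻¹' Metric.ball y₀ r :=
    ⟨h0O₁, by simpa [hA0 _ h0O₁] using hr⟩
  obtain ⟨δ, hδ, hδW⟩ := Metric.isOpen_iff.1 hW _ h0W
  rw [← ball_prod_same] at hδW
  have hAr : ∀ s ∈ Metric.ball (0 : ℝ) δ, ∀ x ∈ Metric.ball y₀ δ,
      (s, x) ∈ O₁ ∧ A (s, x) ∈ Metric.ball y₀ r := fun s hs x hx ↦ hδW ⟨hs, hx⟩
  have hδr : Metric.ball y₀ δ ⊆ Metric.ball y₀ r := fun x hx ↦ by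
    have h := hAr 0 (Metric.mem_ball_self hδ) x hx
    rw [hA0 _ h.1] at h
    exact h.2
  -- the function `f` grows at unit speed along the flow
  have hfA : ∀ s ∈ Metric.ball (0 : ℝ) δ, ∀ x ∈ Metric.ball y₀ δ, f (A (s, x)) = f x + s := by
    intro s hs x hx
    have hd : ∀ t ∈ Metric.ball (0 : ℝ) δ,
        HasDerivAt (fun t ↦ f (A (t, x)) - t) 0 t := by
      intro t ht
      obtain ⟨h1, h2⟩ := hAr t ht x hx
      have h3 : HasDerivAt (fun t ↦ A (t, x)) (X (A (t, x))) t := by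
        rw [← hYX h2]; exact hAd (t, x) h1
      have h4 := ((hf.contDiffAt (hO.mem_nhds (hrO h2))).differentiableAt
        (by simp)).hasFDerivAt.comp_hasDerivAt t h3
      rw [hfX _ (hrO h2)] at h4
      exact (h4.fun_sub (hasDerivAt_id t)).congr_deriv (by simp)
    have h5 := (convex_ball (0 : ℝ) δ).is_const_of_fderivWithin_eq_zero (𝕜 := ℝ)
      (f := fun t ↦ f (A (t, x)) - t)
      (fun t ht ↦ (hd t ht).differentiableAt.differentiableWithinAt)
      (fun t ht ↦ by
        rw [fderivWithin_of_isOpen Metric.isOpen_ball ht]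
        ext; simp [(hd t ht).deriv]) (Metric.mem_ball_self hδ) hs
    simp only [hA0 _ (hAr 0 (Metric.mem_ball_self hδ) x hx).1] at h5
    linarith
  -- starting from `ℓ v`, the flow reaches the level set `{f = t}` at time `t - f (ℓ v)`
  let ℓ : F → E := fun v ↦ y₀ + κ v
  have hℓ : ContDiff ℝ ∞ ℓ := contDiff_const.add κ.contDiff
  have hU : IsOpen (ℓ ⁻¹' Metric.ball y₀ δ) := Metric.isOpen_ball.preimage hℓ.continuous
  let c : ℝ × F → ℝ × E := fun q ↦ (q.1 - f (ℓ q.2), ℓ q.2)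
  have hc : ContDiffOn ℝ ∞ c (univ ×ˢ (ℓ ⁻¹' Metric.ball y₀ δ)) := by
    have h1 : ContDiffOn ℝ ∞ (fun q : ℝ × F ↦ f (ℓ q.2)) (univ ×ˢ (ℓ ⁻¹' Metric.ball y₀ δ)) :=
      hf.comp (hℓ.comp contDiff_snd).contDiffOn fun q hq ↦ hrO (hδr hq.2)
    exact (contDiff_fst.contDiffOn.sub h1).prodMk (hℓ.comp contDiff_snd).contDiffOn
  let D : Set (ℝ × F) := univ ×ˢ (ℓ ⁻¹' Metric.ball y₀ δ)
    ∩ c ⁻¹' (Metric.ball (0 : ℝ) δ ×ˢ Metric.ball y₀ δ)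
  have hD : IsOpen D := hc.continuousOn.isOpen_inter_preimage (isOpen_univ.prod hU)
    (Metric.isOpen_ball.prod Metric.isOpen_ball)
  have hcD : ∀ q ∈ D, c q ∈ O₁ := fun q hq ↦ (hAr _ hq.2.1 _ hq.2.2).1
  have hℓ0 : ℓ 0 = y₀ := by simp [ℓ]
  have hc0 : c 0 = (0, y₀) := by simp [c, hℓ0, hf₀]
  have h0D : (0 : ℝ × F) ∈ D := by
    refine ⟨⟨mem_univ _, ?_⟩, ?_⟩
    · simp only [Prod.snd_zero, mem_preimage, hℓ0]; exact Metric.mem_ball_self hδ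
    · rw [mem_preimage, hc0]; exact ⟨Metric.mem_ball_self hδ, Metric.mem_ball_self hδ⟩
  have hAc : ContDiffOn ℝ ∞ (A ∘ c) D := hA.comp (hc.mono inter_subset_left) hcD
  have hAc' : HasFDerivAt (A ∘ c) (L : ℝ × F →L[ℝ] E) 0 := by
    have hA' := ((hA.contDiffAt (hO₁.mem_nhds h0O₁)).differentiableAt (by simp)).hasFDerivAt
    have h1 : fderiv ℝ A (0, y₀) (1, 0) = X y₀ := by
      have h2 : HasDerivAt (fun t : ℝ ↦ A (t, y₀)) (fderiv ℝ A (0, y₀) (1, 0)) 0 :=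
        HasFDerivAt.comp_hasDerivAt (l := A) 0 hA' ((hasDerivAt_id 0).prodMk (hasDerivAt_const _ _))
      rw [h2.unique (hAd _ h0O₁), hA0 _ h0O₁, hYX (Metric.mem_ball_self hr)]
    have h2 : ∀ w, fderiv ℝ A (0, y₀) (0, w) = w := by
      intro w
      have h3 : HasFDerivAt (fun x : E ↦ A (0, x))
          ((fderiv ℝ A (0, y₀)).comp (ContinuousLinearMap.inr ℝ ℝ E)) y₀ :=
        HasFDerivAt.comp (g := A) y₀ hA' (hasFDerivAt_prodMk_right _ _)
      have h4 : HasFDerivAt (fun x : E ↦ A (0, x)) (ContinuousLinearMap.id ℝ E) y₀ := by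
        refine (hasFDerivAt_id y₀).congr_of_eventuallyEq ?_
        have hev : ∀ᶠ x in 𝓝 y₀, ((0 : ℝ), x) ∈ O₁ :=
          (Continuous.prodMk_right (0 : ℝ)).continuousAt.eventually (hO₁.mem_nhds h0O₁)
        filter_upwards [hev] with x hx
        exact hA0 x hx
      simpa using DFunLike.congr_fun (h3.unique h4) w
    have h5 : HasFDerivAt ℓ κ 0 := κ.hasFDerivAt.const_add y₀
    have h6 : HasFDerivAt f (fderiv ℝ f y₀) (ℓ 0) := by
      rw [hℓ0]; exact ((hf.contDiffAt (hO.mem_nhds hy₀)).differentiableAt (by simp)).hasFDerivAt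
    have hsnd : HasFDerivAt (fun q : ℝ × F ↦ q.2) (ContinuousLinearMap.snd ℝ ℝ F) 0 :=
      hasFDerivAt_snd
    have hfst : HasFDerivAt (fun q : ℝ × F ↦ q.1) (ContinuousLinearMap.fst ℝ ℝ F) 0 :=
      hasFDerivAt_fst
    have h7 : HasFDerivAt (fun q : ℝ × F ↦ ℓ q.2) _ 0 := HasFDerivAt.comp (g := ℓ) 0 h5 hsnd
    have h8 : HasFDerivAt (fun q : ℝ × F ↦ f (ℓ q.2)) _ 0 := HasFDerivAt.comp (g := f) 0 h6 h7
    have h9 : HasFDerivAt c _ 0 := (hfst.sub h8).prodMk h7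
    rw [← hc0] at hA' h1 h2
    convert! hA'.comp 0 h9 using 1
    ext q
    · simpa [hL, hκ] using h1.symm
    · simp [hL, hκ, h2]
  obtain ⟨e, h0e, heD, hef, hec, hes⟩ := exists_openPartialHomeomorph_contDiffOn hD h0D hAc hAc'
  obtain ⟨ε, hε, hεe⟩ := Metric.isOpen_iff.1 e.open_source _ h0e
  rw [show (0 : ℝ × F) = (0, 0) from rfl, ← ball_prod_same] at hεe
  -- reparametrize a ball in `F` by the whole of `F`
  let β := OpenPartialHomeomorph.univBall (0 : F) ε
  have hβ : ∀ v, β v ∈ Metric.ball (0 : F) ε := fun v ↦ by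
    rw [← OpenPartialHomeomorph.univBall_target (0 : F) hε]
    exact β.map_source (by simp [β])
  let P : OpenPartialHomeomorph (ℝ × F) (ℝ × F) :=
    (OpenPartialHomeomorph.ofSet (Metric.ball (0 : ℝ) ε) Metric.isOpen_ball).prod β
  have hPs : P.source = Ioo (-ε) ε ×ˢ univ := by
    simp [P, β, Real.ball_eq_Ioo]
  have hPt : P.target = Metric.ball (0 : ℝ) ε ×ˢ Metric.ball (0 : F) ε := by
    simp [P, β, OpenPartialHomeomorph.univBall_target (0 : F) hε]
  have hPe : P.source ⊆ P ⁻¹' e.source := fun q hq ↦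
    hεe (by rw [← hPt]; exact P.map_source hq)
  have hΨs : (P.trans e).source = Ioo (-ε) ε ×ˢ univ := by
    rw [OpenPartialHomeomorph.trans_source, inter_eq_left.2 hPe, hPs]
  have hΨD : ∀ q ∈ (P.trans e).source, P q ∈ D := fun q hq ↦ heD hq.2
  have hΨf : ∀ q, (P.trans e) q = A (c (q.1, β q.2)) := fun q ↦ hef _
  have hPc : ContDiff ℝ ∞ P :=
    contDiff_fst.prodMk (OpenPartialHomeomorph.contDiff_univBall.comp contDiff_snd)
  have hPsc : ContDiffOn ℝ ∞ P.symm P.target := by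
    rw [hPt]
    exact contDiffOn_fst.prodMk (OpenPartialHomeomorph.contDiffOn_univBall_symm.comp contDiffOn_snd
      fun q hq ↦ hq.2)
  refine ⟨ε, P.trans e, hε, hΨs, ?_, ?_, ?_, ?_, ?_, ?_⟩
  · intro y hy
    obtain ⟨q, hq, rfl⟩ : ∃ q ∈ (P.trans e).source, (P.trans e) q = y :=
      ⟨_, (P.trans e).map_target hy, (P.trans e).right_inv hy⟩
    rw [hΨf]
    exact hrO (hAr _ (hΨD q hq).2.1 _ (hΨD q hq).2.2).2
  · have h0 : (0 : ℝ × F) ∈ (P.trans e).source := by rw [hΨs]; simp [hε]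
    have h1 := (P.trans e).map_source h0
    have h2 : β 0 = 0 := OpenPartialHomeomorph.univBall_apply_zero 0 ε
    have h3 : ((0 : ℝ), (0 : F)) = 0 := rfl
    rwa [hΨf, Prod.snd_zero, h2, Prod.fst_zero, h3, hc0, hA0 _ h0O₁] at h1
  · exact hec.comp hPc.contDiffOn fun q hq ↦ hq.2
  · exact hPsc.comp (hes.mono inter_subset_left) fun y hy ↦ hy.2
  · intro q hq
    simp only [hΨf]
    have h1 := hΨD q hq
    obtain ⟨h2, h3⟩ := hAr _ h1.2.1 _ h1.2.2
    have h4 := hAd _ h2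
    rw [hYX h3] at h4
    exact HasDerivAt.comp_sub_const (f := fun t ↦ A (t, ℓ (β q.2))) q.1 (f (ℓ (β q.2))) h4
  · intro q hq
    rw [hΨf]
    have h1 := hΨD q hq
    refine (hfA _ h1.2.1 _ h1.2.2).trans ?_
    change f (ℓ (β q.2)) + (q.1 - f (ℓ (β q.2))) = q.1
    ring

end FlowBox

/-! ### Transport of fields along partial diffeomorphisms from a vector space -/

section VectorSpace

variable {W : Type*} [NormedAddCommGroup W] [NormedSpace ℝ W] {q : W}

/-- A map from a vector space to itself, regarded as a vector field on the manifold `W`. -/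
def asField (X : W → W) : Π q : W, TangentSpace 𝓘(ℝ, W) q := X

theorem mdifferentiableAt_asField {X : W → W} :
    MDiffAt (T% (asField X)) q ↔ DifferentiableAt ℝ X q := by
  rw [mdifferentiableAt_totalSpace, ← mdifferentiableAt_iff_differentiableAt]
  simp only [trivializationAt_model_space_apply]
  exact ⟨fun h ↦ h.2, fun h ↦ ⟨mdifferentiableAt_id, h⟩⟩

theorem mlieBracket_asField (X Y : W → W) :
    VectorField.mlieBracket 𝓘(ℝ, W) (asField X) (asField Y) q = VectorField.lieBracket ℝ X Y q := by
  rw [← VectorField.mlieBracketWithin_univ, VectorField.mlieBracketWithin_eq_lieBracketWithin,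
    ← VectorField.lieBracketWithin_univ]
  rfl

end VectorSpace

section Transport

variable {W : Type*} [NormedAddCommGroup W] [NormedSpace ℝ W]
  {E : Type*} [NormedAddCommGroup E] [NormedSpace ℝ E]
  {M : Type*} [TopologicalSpace M] [ChartedSpace E M]
  (Φ : PartialDiffeomorph 𝓘(ℝ, W) 𝓘(ℝ, E) W M ∞) {q : W}

/-- The differential of `Φ` at `q`, with the tangent space of the vector space `W` identified
with `W`. -/
def differential (q : W) : W →L[ℝ] TangentSpace 𝓘(ℝ, E) (Φ q) :=
  mfderiv 𝓘(ℝ, W) 𝓘(ℝ, E) Φ q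

/-- The differential of the inverse of `Φ`, with the tangent spaces of `W` identified with `W`. -/
def codifferential (y : M) : TangentSpace 𝓘(ℝ, E) y →L[ℝ] W :=
  mfderiv 𝓘(ℝ, E) 𝓘(ℝ, W) Φ.symm y

theorem contMDiffAt_apply (hq : q ∈ Φ.source) : ContMDiffAt 𝓘(ℝ, W) 𝓘(ℝ, E) ∞ Φ q :=
  Φ.contMDiffOn.contMDiffAt (Φ.open_source.mem_nhds hq)

theorem contMDiffAt_symm_apply (hq : q ∈ Φ.source) :
    ContMDiffAt 𝓘(ℝ, E) 𝓘(ℝ, W) ∞ Φ.symm (Φ q) :=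
  Φ.symm.contMDiffOn.contMDiffAt (Φ.open_target.mem_nhds (Φ.map_source hq))

theorem symm_apply_apply (hq : q ∈ Φ.source) : Φ.symm (Φ q) = q := Φ.left_inv hq

theorem codifferential_differential (hq : q ∈ Φ.source) (a : W) :
    codifferential Φ (Φ q) (differential Φ q a) = a := by
  have h1 : (Φ.symm ∘ Φ) =ᶠ[𝓝 q] id := by
    filter_upwards [Φ.open_source.mem_nhds hq] with x hx using Φ.left_inv hx
  have h2 := h1.mfderiv_eq (I := 𝓘(ℝ, W)) (I' := 𝓘(ℝ, W))
  rw [mfderiv_comp q ((contMDiffAt_symm_apply Φ hq).mdifferentiableAt (by simp))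
    ((contMDiffAt_apply Φ hq).mdifferentiableAt (by simp)), mfderiv_id] at h2
  exact DFunLike.congr_fun h2 a

theorem differential_codifferential (hq : q ∈ Φ.source) (b : TangentSpace 𝓘(ℝ, E) (Φ q)) :
    differential Φ q (codifferential Φ (Φ q) b) = b := by
  have h1 : (Φ ∘ Φ.symm) =ᶠ[𝓝 (Φ q)] id := by
    filter_upwards [Φ.open_target.mem_nhds (Φ.map_source hq)] with x hx using Φ.right_inv hx
  have h2 := h1.mfderiv_eq (I := 𝓘(ℝ, E)) (I' := 𝓘(ℝ, E))
  have h3 : Φ.symm (Φ q) = q := symm_apply_apply Φ hq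
  rw [mfderiv_comp_of_eq ((contMDiffAt_apply Φ hq).mdifferentiableAt (by simp))
    ((contMDiffAt_symm_apply Φ hq).mdifferentiableAt (by simp)) h3, mfderiv_id] at h2
  have h4 : differential Φ (Φ.symm (Φ q)) (codifferential Φ (Φ q) b) = b :=
    DFunLike.congr_fun h2 b
  have h5 : ∀ x, x = q → ∀ w : W, HEq (differential Φ x w) (differential Φ q w) := by
    rintro x rfl w; rfl
  exact eq_of_heq ((h5 _ h3 _).symm.trans (heq_of_eq h4))

/-- The differential of a partial diffeomorphism at a point of its source, as a linear
isomorphism. -/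
def tangentEquiv (hq : q ∈ Φ.source) : W ≃L[ℝ] TangentSpace 𝓘(ℝ, E) (Φ q) :=
  ContinuousLinearEquiv.equivOfInverse (differential Φ q) (codifferential Φ (Φ q))
    (codifferential_differential Φ hq) (differential_codifferential Φ hq)

/-- The vector field on the target of `Φ` that corresponds to the field `X` on its source. -/
def push (X : W → W) : Π y : M, TangentSpace 𝓘(ℝ, E) y :=
  VectorField.mpullback 𝓘(ℝ, E) 𝓘(ℝ, W) Φ.symm (asField X)

/-- The vector field on the source of `Φ` that corresponds to the field `Z` on its target. -/
def pull (Z : Π y : M, TangentSpace 𝓘(ℝ, E) y) : W → W :=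
  VectorField.mpullback 𝓘(ℝ, W) 𝓘(ℝ, E) Φ Z

theorem isInvertible_mfderiv_symm (hq : q ∈ Φ.source) :
    (mfderiv 𝓘(ℝ, E) 𝓘(ℝ, W) Φ.symm (Φ q)).IsInvertible := ⟨(tangentEquiv Φ hq).symm, rfl⟩

theorem isInvertible_mfderiv (hq : q ∈ Φ.source) :
    (mfderiv 𝓘(ℝ, W) 𝓘(ℝ, E) Φ q).IsInvertible := ⟨tangentEquiv Φ hq, rfl⟩

theorem push_apply (hq : q ∈ Φ.source) (X : W → W) :
    push Φ X (Φ q) = differential Φ q (X q) := by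
  have h1 : push Φ X (Φ q) = (codifferential Φ (Φ q)).inverse (X (Φ.symm (Φ q))) := rfl
  have h2 : codifferential Φ (Φ q)
    = ((tangentEquiv Φ hq).symm : TangentSpace 𝓘(ℝ, E) (Φ q) →L[ℝ] W) := rfl
  rw [h1, h2, ContinuousLinearMap.inverse_equiv, symm_apply_apply Φ hq]
  rfl

theorem pull_apply (hq : q ∈ Φ.source) (Z : Π y : M, TangentSpace 𝓘(ℝ, E) y) :
    pull Φ Z q = codifferential Φ (Φ q) (Z (Φ q)) := by
  have h1 : pull Φ Z q = (differential Φ q).inverse (Z (Φ q)) := rfl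
  have h2 : differential Φ q
    = (tangentEquiv Φ hq : W →L[ℝ] TangentSpace 𝓘(ℝ, E) (Φ q)) := rfl
  rw [h1, h2, ContinuousLinearMap.inverse_equiv]
  rfl

theorem eventually_target {P : M → Prop} (hq : q ∈ Φ.source) (h : ∀ x ∈ Φ.source, P (Φ x)) :
    ∀ᶠ y in 𝓝 (Φ q), P y := by
  filter_upwards [Φ.open_target.mem_nhds (Φ.map_source hq)] with y hy
  rw [← Φ.right_inv hy]
  exact h _ (Φ.map_target hy)

theorem mvfderiv_differential (hq : q ∈ Φ.source) {u : M → ℝ} (hu : MDiffAt u (Φ q)) (a : W) :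
    mvfderiv 𝓘(ℝ, E) u (Φ q) (differential Φ q a) = fderiv ℝ (fun x ↦ u (Φ x)) q a := by
  have := mvfderiv_comp_apply (I := 𝓘(ℝ, E)) (I' := 𝓘(ℝ, W)) (f := Φ) q hu
    ((contMDiffAt_apply Φ hq).mdifferentiableAt (by simp)) a
  refine this.symm.trans ?_
  change mfderiv 𝓘(ℝ, W) 𝓘(ℝ, ℝ) (u ∘ Φ) q a = _
  rw [mfderiv_eq_fderiv]
  rfl

theorem contDiffAt_comp {u : M → ℝ} (hq : q ∈ Φ.source) (hu : CMDiffAt ∞ u (Φ q)) :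
    ContDiffAt ℝ ∞ (fun x ↦ u (Φ x)) q :=
  contMDiffAt_iff_contDiffAt.1 (hu.comp q (contMDiffAt_apply Φ hq))

theorem differentiableAt_comp {u : M → ℝ} (hq : q ∈ Φ.source) (hu : MDiffAt u (Φ q)) :
    DifferentiableAt ℝ (fun x ↦ u (Φ x)) q :=
  mdifferentiableAt_iff_differentiableAt.1
    (hu.comp q ((contMDiffAt_apply Φ hq).mdifferentiableAt (by simp)))

variable [IsManifold 𝓘(ℝ, E) ∞ M]

theorem contDiffAt_pull [CompleteSpace W] (hq : q ∈ Φ.source)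
    {Z : Π y : M, TangentSpace 𝓘(ℝ, E) y} (hZ : CMDiffAt ∞ (T% Z) (Φ q)) :
    ContDiffAt ℝ ∞ (pull Φ Z) q :=
  contMDiffAt_vectorSpace_iff_contDiffAt.1 <|
    ContMDiffAt.mpullback_vectorField_preimage (n := ∞) hZ (contMDiffAt_apply Φ hq)
      (isInvertible_mfderiv Φ hq) (by simp)

variable [CompleteSpace E]

theorem contMDiffAt_push (hq : q ∈ Φ.source) {X : W → W} (hX : ContDiffAt ℝ ∞ X q) :
    CMDiffAt ∞ (T% (push Φ X)) (Φ q) := by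
  refine ContMDiffAt.mpullback_vectorField_preimage (n := ∞) ?_ (contMDiffAt_symm_apply Φ hq)
    (isInvertible_mfderiv_symm Φ hq) (by simp)
  rw [symm_apply_apply Φ hq]
  exact contMDiffAt_vectorSpace_iff_contDiffAt.2 hX

theorem mdifferentiableAt_push (hq : q ∈ Φ.source) {X : W → W} (hX : DifferentiableAt ℝ X q) :
    MDiffAt (T% (push Φ X)) (Φ q) := by
  have := IsManifold.of_le (I := 𝓘(ℝ, E)) (M := M) (m := 2) (n := ∞)
    (WithTop.coe_le_coe.2 le_top)
  refine MDifferentiableAt.mpullback_vectorField (n := ∞) ?_ (contMDiffAt_symm_apply Φ hq)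
    (isInvertible_mfderiv_symm Φ hq) (WithTop.coe_le_coe.2 le_top)
  rw [symm_apply_apply Φ hq]
  exact mdifferentiableAt_asField.2 hX

theorem mlieBracket_push (hq : q ∈ Φ.source) {X Y : W → W} (hX : DifferentiableAt ℝ X q)
    (hY : DifferentiableAt ℝ Y q) :
    VectorField.mlieBracket 𝓘(ℝ, E) (push Φ X) (push Φ Y) (Φ q)
      = differential Φ q (VectorField.lieBracket ℝ X Y q) := by
  have hle : minSmoothness ℝ 2 ≤ ∞ := by
    rw [minSmoothness_of_isRCLikeNormedField]
    exact WithTop.coe_le_coe.2 le_top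
  have := IsManifold.of_le (I := 𝓘(ℝ, E)) (M := M) hle
  have h3 : Φ.symm (Φ q) = q := symm_apply_apply Φ hq
  have h := VectorField.mpullback_mlieBracket (I := 𝓘(ℝ, E)) (I' := 𝓘(ℝ, W)) (n := ∞)
    (f := Φ.symm) (x₀ := Φ q) (V := asField X) (W := asField Y)
    (by rw [h3]; exact mdifferentiableAt_asField.2 hX)
    (by rw [h3]; exact mdifferentiableAt_asField.2 hY) (contMDiffAt_symm_apply Φ hq) hle
  exact h.symm.trans ((push_apply Φ hq
    (VectorField.mlieBracket 𝓘(ℝ, W) (asField X) (asField Y))).trans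
      (congrArg (differential Φ q) (mlieBracket_asField X Y)))

end Transport

/-! ### Calculus of the Levi-Civita connection -/

theorem mvfderiv_congr {E : Type*} [NormedAddCommGroup E] [NormedSpace ℝ E]
    {M : Type*} [TopologicalSpace M] [ChartedSpace E M] {x : M} {u u' : M → ℝ}
    (h : u' =ᶠ[𝓝 x] u) (v : TangentSpace 𝓘(ℝ, E) x) :
    mvfderiv 𝓘(ℝ, E) u' x v = mvfderiv 𝓘(ℝ, E) u x v := by
  have h1 := h.mfderiv_eq (I := 𝓘(ℝ, E)) (I' := 𝓘(ℝ, ℝ))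
  exact DFunLike.congr_fun (F := E →L[ℝ] ℝ) h1 v

section Connection

variable {E : Type*} [NormedAddCommGroup E] [NormedSpace ℝ E]
  {M : Type*} [TopologicalSpace M] [ChartedSpace E M] [IsManifold 𝓘(ℝ, E) ∞ M]
  {g : Metric E M} {X Y Z : Π x : M, TangentSpace 𝓘(ℝ, E) x} {x : M}

theorem eq_of_inner_eq (g : Metric E M) {a b : TangentSpace 𝓘(ℝ, E) x}
    (h : ∀ z, g.inner x a z = g.inner x b z) : a = b := by
  by_contra hne
  have h1 := g.pos x _ (sub_ne_zero.2 hne)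
  have h2 := h (a - b)
  simp only [map_sub, sub_apply] at h1 h2
  linarith

/-- Two vectors agree if they have the same inner product with the values of all vector fields
that are differentiable at the point. -/
theorem eq_of_inner_field_eq (g : Metric E M) {a b : TangentSpace 𝓘(ℝ, E) x}
    (h : ∀ Z : Π x : M, TangentSpace 𝓘(ℝ, E) x, MDiffAt (T% Z) x →
      g.inner x a (Z x) = g.inner x b (Z x)) : a = b := by
  refine eq_of_inner_eq g fun z ↦ ?_
  have h1 := h (FiberBundle.extend E z) (FiberBundle.mdifferentiableAt_extend ..)
  rwa [FiberBundle.extend_apply_self] at h1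

theorem mdifferentiableAt_end_apply
    {A : Π x : M, TangentSpace 𝓘(ℝ, E) x →L[ℝ] TangentSpace 𝓘(ℝ, E) x}
    {s : Set M} (hs : IsOpen s) (hA : SmoothEnd A s) (hx : x ∈ s) (hY : MDiffAt (T% Y) x) :
    MDiffAt (T% (fun y ↦ A y (Y y))) x :=
  MDifferentiableAt.clm_bundle_apply
    ((hA.contMDiffAt (hs.mem_nhds hx)).mdifferentiableAt (by simp)) hY

theorem contMDiffAt_end_apply
    {A : Π x : M, TangentSpace 𝓘(ℝ, E) x →L[ℝ] TangentSpace 𝓘(ℝ, E) x}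
    {s : Set M} (hs : IsOpen s) (hA : SmoothEnd A s) (hx : x ∈ s) (hY : CMDiffAt ∞ (T% Y) x) :
    CMDiffAt ∞ (T% (fun y ↦ A y (Y y))) x :=
  ContMDiffAt.clm_bundle_apply (hA.contMDiffAt (hs.mem_nhds hx)) hY

theorem contMDiffAt_inner (g : Metric E M) (hX : CMDiffAt ∞ (T% X) x) (hY : CMDiffAt ∞ (T% Y) x) :
    CMDiffAt ∞ (fun y ↦ g.inner y (X y) (Y y)) x := by
  have := ContMDiffAt.clm_bundle_apply₂ (E₃ := fun _ : M ↦ ℝ) (F₃ := ℝ) (g.contMDiff x) hX hY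
  rw [contMDiffAt_totalSpace] at this
  exact this.2

variable [FiniteDimensional ℝ E]

theorem inner_leviCivita (g : Metric E M) (hY : MDiffAt (T% Y) x) (hZ : MDiffAt (T% Z) x)
    (v : TangentSpace 𝓘(ℝ, E) x) :
    g.inner x (leviCivita g Y x v) (Z x)
      = mvfderiv 𝓘(ℝ, E) (fun y ↦ g.inner y (Y y) (Z y)) x v
        - g.inner x (Y x) (leviCivita g Z x v) := by
  have h1 := leviCivita_metric g
    (FiberBundle.mdifferentiableAt_extend 𝓘(ℝ, E) (F := E) (v : TangentSpace 𝓘(ℝ, E) x)) hY hZ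
  rw [FiberBundle.extend_apply_self] at h1
  linarith

theorem leviCivita_congr {Y' : Π x : M, TangentSpace 𝓘(ℝ, E) x} (hY : MDiffAt (T% Y) x)
    (h : Y' =ᶠ[𝓝 x] Y) : leviCivita g Y' x = leviCivita g Y x := by
  have hT : (T% Y') =ᶠ[𝓝 x] (T% Y) := by
    filter_upwards [h] with y hy
    simp only [hy]
  have hY' : MDiffAt (T% Y') x := hY.congr_of_eventuallyEq hT
  ext v
  refine eq_of_inner_field_eq g fun Z hZ ↦ ?_
  rw [inner_leviCivita g hY hZ, inner_leviCivita g hY' hZ, h.self_of_nhds]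
  have h2 : (fun y ↦ g.inner y (Y' y) (Z y)) =ᶠ[𝓝 x] fun y ↦ g.inner y (Y y) (Z y) := by
    filter_upwards [h] with y hy
    rw [hy]
  rw [mvfderiv_congr h2]

theorem leviCivita_zero : leviCivita g (fun y ↦ (0 : TangentSpace 𝓘(ℝ, E) y)) x = 0 := by
  ext v
  have h0 : MDiffAt (T% (fun y : M ↦ (0 : TangentSpace 𝓘(ℝ, E) y))) x :=
    (contMDiff_zeroSection ℝ (fun y : M ↦ TangentSpace 𝓘(ℝ, E) y) x).mdifferentiableAt
      (n := ∞) (by simp)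
  refine eq_of_inner_field_eq g fun Z hZ ↦ ?_
  rw [inner_leviCivita g h0 hZ]
  simp only [map_zero, zero_apply, sub_zero]
  exact DFunLike.congr_fun (mvfderiv_const (0 : ℝ)) v

theorem leviCivita_add (hX : MDiffAt (T% X) x) (hY : MDiffAt (T% Y) x)
    (v : TangentSpace 𝓘(ℝ, E) x) :
    leviCivita g (fun y ↦ X y + Y y) x v = leviCivita g X x v + leviCivita g Y x v := by
  have hXY : MDiffAt (T% (fun y ↦ X y + Y y)) x := mdifferentiableAt_add_section hX hY
  refine eq_of_inner_field_eq g fun Z hZ ↦ ?_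
  have e : (fun y ↦ g.inner y (X y + Y y) (Z y))
      = (fun y ↦ g.inner y (X y) (Z y)) + fun y ↦ g.inner y (Y y) (Z y) := by ext y; simp
  rw [inner_leviCivita g hXY hZ, e,
    mvfderiv_add (mdifferentiableAt_inner hX hZ) (mdifferentiableAt_inner hY hZ)]
  simp only [map_add, add_apply, inner_leviCivita g hX hZ, inner_leviCivita g hY hZ]
  ring

/-- The Leibniz rule for the Levi-Civita connection. -/
theorem leviCivita_smul {f : M → ℝ} (hf : MDiffAt f x) (hY : MDiffAt (T% Y) x)
    (v : TangentSpace 𝓘(ℝ, E) x) :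
    leviCivita g (fun y ↦ f y • Y y) x v
      = mvfderiv 𝓘(ℝ, E) f x v • Y x + f x • leviCivita g Y x v := by
  have hfY : MDiffAt (T% (fun y ↦ f y • Y y)) x := hf.smul_section hY
  refine eq_of_inner_field_eq g fun Z hZ ↦ ?_
  have e : (fun y ↦ g.inner y (f y • Y y) (Z y)) = f * fun y ↦ g.inner y (Y y) (Z y) := by
    ext y; simp
  rw [inner_leviCivita g hfY hZ, e, mvfderiv_mul hf (mdifferentiableAt_inner hY hZ)]
  simp only [map_add, map_smul, add_apply, smul_apply, smul_eq_mul,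
    inner_leviCivita g hY hZ]
  ring

end Connection

/-! ### Identities on Kenmotsu manifolds -/

section Kenmotsu

variable {E : Type*} [NormedAddCommGroup E] [NormedSpace ℝ E]
  {M : Type*} [TopologicalSpace M] [ChartedSpace E M] [IsManifold 𝓘(ℝ, E) ∞ M]
  {g : Metric E M} {φ : Π x : M, TangentSpace 𝓘(ℝ, E) x →L[ℝ] TangentSpace 𝓘(ℝ, E) x}
  {ξ : Π x : M, TangentSpace 𝓘(ℝ, E) x} {η : Π x : M, TangentSpace 𝓘(ℝ, E) x →L[ℝ] ℝ}
  {X Y : Π x : M, TangentSpace 𝓘(ℝ, E) x} {x : M}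

namespace IsAlmostContactMetric

variable (h : IsAlmostContactMetric g φ ξ η)
include h

theorem inner_xi_xi (x : M) : g.inner x (ξ x) (ξ x) = 1 := by
  rw [← h.eta_dual, h.eta_xi]

/-- `φ` is skew-symmetric. -/
theorem inner_phi_left (x : M) (v w : TangentSpace 𝓘(ℝ, E) x) :
    g.inner x (φ x v) w = -g.inner x v (φ x w) := by
  have h1 := h.metric_phi x v (φ x w)
  rw [h.phi_sq, h.eta_phi, map_add, map_neg, map_smul, g.symm x (φ x v) (ξ x), ← h.eta_dual,
    h.eta_phi] at h1
  simp at h1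
  linarith

theorem mdifferentiableAt_xi (x : M) : MDiffAt (T% ξ) x :=
  (h.smooth_xi.contMDiffAt Filter.univ_mem).mdifferentiableAt (by simp)

theorem mdifferentiableAt_eta (hX : MDiffAt (T% X) x) : MDiffAt (fun y ↦ η y (X y)) x := by
  simp only [h.eta_dual]
  exact mdifferentiableAt_inner (h.mdifferentiableAt_xi x) hX

theorem mdifferentiableAt_phi (hX : MDiffAt (T% X) x) : MDiffAt (T% (fun y ↦ φ y (X y))) x :=
  mdifferentiableAt_end_apply isOpen_univ h.smooth_phi (mem_univ x) hX

end IsAlmostContactMetric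

/-- The structure tensors of a 3-Kenmotsu structure anticommute, since they are skew-symmetric. -/
theorem IsThreeKenmotsu.phi_anticomp
    {φ : Fin 3 → Π x : M, TangentSpace 𝓘(ℝ, E) x →L[ℝ] TangentSpace 𝓘(ℝ, E) x}
    (hM : IsThreeKenmotsu g φ ξ η) (i : Fin 3) (x : M) (w : TangentSpace 𝓘(ℝ, E) x) :
    φ (i + 1) x (φ i x w) = -φ (i + 2) x w := by
  refine eq_of_inner_eq g fun z ↦ ?_
  rw [(hM.kenmotsu _).inner_phi_left, (hM.kenmotsu _).inner_phi_left, neg_neg, ← hM.comp,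
    map_neg, neg_apply, (hM.kenmotsu _).inner_phi_left, neg_neg]

namespace IsKenmotsu

variable [FiniteDimensional ℝ E] (h : IsKenmotsu g φ ξ η)
include h

/-- On a Kenmotsu manifold `∇_v ξ = v - η(v) ξ`: the identity for `∇φ`, evaluated on `ξ`, gives
this up to a multiple of `ξ`, and `∇_v ξ` is orthogonal to the unit field `ξ`. -/
theorem leviCivita_xi (x : M) (v : TangentSpace 𝓘(ℝ, E) x) :
    leviCivita g ξ x v = v - η x v • ξ x := by
  have hξ := h.mdifferentiableAt_xi x
  have h1 : φ x (leviCivita g ξ x v) = φ x v := by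
    have h2 := h.nabla_phi x v ξ hξ
    have h3 : (fun y ↦ φ y (ξ y)) = fun y ↦ (0 : TangentSpace 𝓘(ℝ, E) y) := funext h.phi_xi
    rw [nablaEnd, h3, leviCivita_zero, h.eta_xi, g.symm, ← h.eta_dual, h.eta_phi] at h2
    simpa using h2
  have h4 : η x (leviCivita g ξ x v) = 0 := by
    have h5 := inner_leviCivita g hξ hξ v
    have h6 : (fun y ↦ g.inner y (ξ y) (ξ y)) = fun _ ↦ (1 : ℝ) := funext h.inner_xi_xi
    have h7 : mvfderiv 𝓘(ℝ, E) (fun y ↦ g.inner y (ξ y) (ξ y)) x v = 0 := by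
      rw [h6]; exact DFunLike.congr_fun (mvfderiv_const (1 : ℝ)) v
    rw [h7, g.symm] at h5
    rw [h.eta_dual]
    linarith
  have h8 := congrArg (φ x) h1
  rw [h.phi_sq, h.phi_sq, h4, zero_smul, add_zero] at h8
  rw [← neg_inj, h8]
  abel

/-- The flow of `ξ` rescales the metric orthogonally to `ξ`: the Lie derivative of `g` along `ξ`
is `2 (g - η ⊗ η)`. -/
theorem mvfderiv_inner_xi (hX : MDiffAt (T% X) x) (hY : MDiffAt (T% Y) x) :
    mvfderiv 𝓘(ℝ, E) (fun y ↦ g.inner y (X y) (Y y)) x (ξ x)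
      = g.inner x (VectorField.mlieBracket 𝓘(ℝ, E) ξ X x) (Y x)
        + g.inner x (X x) (VectorField.mlieBracket 𝓘(ℝ, E) ξ Y x)
        + 2 * (g.inner x (X x) (Y x) - η x (X x) * η x (Y x)) := by
  have hξ := h.mdifferentiableAt_xi x
  rw [leviCivita_metric g hξ hX hY, ← leviCivita_torsion g hξ hX, ← leviCivita_torsion g hξ hY,
    h.leviCivita_xi, h.leviCivita_xi]
  simp only [map_sub, map_smul, sub_apply, smul_apply, smul_eq_mul, ← h.eta_dual]
  rw [g.symm x (X x) (ξ x), ← h.eta_dual]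
  ring

/-- The form `η` is closed, because `∇ξ` is symmetric. -/
theorem mvfderiv_eta_sub (hX : MDiffAt (T% X) x) (hY : MDiffAt (T% Y) x) :
    mvfderiv 𝓘(ℝ, E) (fun y ↦ η y (Y y)) x (X x) - mvfderiv 𝓘(ℝ, E) (fun y ↦ η y (X y)) x (Y x)
      = η x (VectorField.mlieBracket 𝓘(ℝ, E) X Y x) := by
  have hξ := h.mdifferentiableAt_xi x
  simp only [h.eta_dual]
  rw [leviCivita_metric g hX hξ hY, leviCivita_metric g hY hξ hX, ← leviCivita_torsion g hX hY,
    h.leviCivita_xi, h.leviCivita_xi]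
  simp only [map_sub, map_smul, sub_apply, smul_apply, smul_eq_mul, ← h.eta_dual]
  rw [g.symm x (X x) (Y x)]
  ring

/-- The flow of `ξ` preserves `φ`. -/
theorem mlieBracket_xi_phi (hX : MDiffAt (T% X) x) :
    VectorField.mlieBracket 𝓘(ℝ, E) ξ (fun y ↦ φ y (X y)) x
      = φ x (VectorField.mlieBracket 𝓘(ℝ, E) ξ X x) := by
  have hξ := h.mdifferentiableAt_xi x
  have h1 := h.nabla_phi x (ξ x) X hX
  rw [h.phi_xi, nablaEnd, map_zero, smul_zero, zero_apply, zero_smul, sub_zero, sub_eq_zero] at h1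
  rw [← leviCivita_torsion g hξ hX, ← leviCivita_torsion g hξ (h.mdifferentiableAt_phi hX), h1,
    h.leviCivita_xi, h.leviCivita_xi, h.eta_phi]
  simp [h.phi_xi]

end IsKenmotsu

end Kenmotsu

/-! ### Coordinates adapted to a Kenmotsu structure -/

section AdaptedChart

variable {E : Type*} [NormedAddCommGroup E] [NormedSpace ℝ E]
  {M : Type*} [TopologicalSpace M] [ChartedSpace E M] [IsManifold 𝓘(ℝ, E) ∞ M]
  {F : Type*} [NormedAddCommGroup F]

/-- The inverse of the preferred chart at `p`, as a partial diffeomorphism from the model space. -/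
def chartSymm (p : M) : PartialDiffeomorph 𝓘(ℝ, E) 𝓘(ℝ, E) E M ∞ where
  toPartialEquiv := (extChartAt 𝓘(ℝ, E) p).symm
  open_source := isOpen_extChartAt_target p
  open_target := isOpen_extChartAt_source p
  contMDiffOn_toFun := contMDiffOn_extChartAt_symm p
  contMDiffOn_invFun := by
    rw [PartialEquiv.symm_target, extChartAt_source]
    exact contMDiffOn_extChartAt (I := 𝓘(ℝ, E)) (x := p)

/-- A partial diffeomorphism `Φ` from `(-ε, ε) × F` to `M` is adapted to the vector field `ξ` and
the `1`-form `η` if `ξ = ∂/∂t` and `η = dt` in the coordinates `(t, v)` given by `Φ`. -/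
structure IsAdapted [NormedSpace ℝ F] (ξ : Π x : M, TangentSpace 𝓘(ℝ, E) x)
    (η : Π x : M, TangentSpace 𝓘(ℝ, E) x →L[ℝ] ℝ) (ε : ℝ)
    (Φ : PartialDiffeomorph 𝓘(ℝ, ℝ × F) 𝓘(ℝ, E) (ℝ × F) M ∞) : Prop where
  pos : 0 < ε
  source_eq : Φ.source = Ioo (-ε) ε ×ˢ univ
  differential_fst : ∀ q ∈ Φ.source, differential Φ q (1, 0) = ξ (Φ q)
  eta_differential : ∀ q ∈ Φ.source, ∀ a, η (Φ q) (differential Φ q a) = a.1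

variable [FiniteDimensional ℝ E] {g : Metric E M}
  {φ : Π x : M, TangentSpace 𝓘(ℝ, E) x →L[ℝ] TangentSpace 𝓘(ℝ, E) x}
  {ξ : Π x : M, TangentSpace 𝓘(ℝ, E) x} {η : Π x : M, TangentSpace 𝓘(ℝ, E) x →L[ℝ] ℝ}

/-- The pullback of a `1`-form to the source of a partial diffeomorphism. -/
def pullForm {W : Type*} [NormedAddCommGroup W] [NormedSpace ℝ W]
    (Φ : PartialDiffeomorph 𝓘(ℝ, W) 𝓘(ℝ, E) W M ∞)
    (η : Π x : M, TangentSpace 𝓘(ℝ, E) x →L[ℝ] ℝ) (q : W) : W →L[ℝ] ℝ :=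
  (η (Φ q)).comp (differential Φ q)

theorem contDiffOn_pullForm (h : IsAlmostContactMetric g φ ξ η) {W : Type*} [NormedAddCommGroup W]
    [NormedSpace ℝ W] [FiniteDimensional ℝ W]
    (Φ : PartialDiffeomorph 𝓘(ℝ, W) 𝓘(ℝ, E) W M ∞) :
    ContDiffOn ℝ ∞ (pullForm Φ η) Φ.source := by
  have : CompleteSpace E := FiniteDimensional.complete ℝ E
  rw [contDiffOn_clm_apply]
  intro a q hq
  have h1 : CMDiffAt ∞ (fun y ↦ g.inner y (ξ y) (push Φ (fun _ ↦ a) y)) (Φ q) :=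
    contMDiffAt_inner g (h.smooth_xi.contMDiffAt Filter.univ_mem)
      (contMDiffAt_push Φ hq contDiffAt_const)
  refine ((contDiffAt_comp Φ hq h1).congr_of_eventuallyEq ?_).contDiffWithinAt
  filter_upwards [Φ.open_source.mem_nhds hq] with x hx
  rw [push_apply Φ hx, ← h.eta_dual]
  rfl

theorem fderiv_pullForm_symm (h : IsKenmotsu g φ ξ η) {W : Type*} [NormedAddCommGroup W]
    [NormedSpace ℝ W] [FiniteDimensional ℝ W]
    (Φ : PartialDiffeomorph 𝓘(ℝ, W) 𝓘(ℝ, E) W M ∞) {q : W} (hq : q ∈ Φ.source) (a b : W) :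
    fderiv ℝ (pullForm Φ η) q a b = fderiv ℝ (pullForm Φ η) q b a := by
  have : CompleteSpace E := FiniteDimensional.complete ℝ E
  have hd : DifferentiableAt ℝ (pullForm Φ η) q :=
    ((contDiffOn_pullForm h.toIsAlmostContactMetric Φ).contDiffAt
      (Φ.open_source.mem_nhds hq)).differentiableAt (by simp)
  have hp : ∀ c : W, MDiffAt (T% (push Φ (fun _ ↦ c))) (Φ q) := fun c ↦
    mdifferentiableAt_push Φ hq (differentiableAt_const c)
  have key : ∀ a b : W, fderiv ℝ (pullForm Φ η) q a b
      = mvfderiv 𝓘(ℝ, E) (fun y ↦ η y (push Φ (fun _ ↦ b) y)) (Φ q) (push Φ (fun _ ↦ a) (Φ q)) := by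
    intro a b
    rw [push_apply Φ hq, mvfderiv_differential Φ hq (h.mdifferentiableAt_eta (hp b))]
    have h1 : (fun x ↦ η (Φ x) (push Φ (fun _ ↦ b) (Φ x))) =ᶠ[𝓝 q] fun x ↦ pullForm Φ η x b := by
      filter_upwards [Φ.open_source.mem_nhds hq] with x hx
      rw [push_apply Φ hx]
      rfl
    rw [h1.fderiv_eq, fderiv_clm_apply hd (differentiableAt_const b)]
    simp
  have h2 := h.mvfderiv_eta_sub (hp a) (hp b)
  rw [← key, ← key, mlieBracket_push Φ hq (differentiableAt_const a) (differentiableAt_const b),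
    show VectorField.lieBracket ℝ (fun _ ↦ a) (fun _ ↦ b) q = 0 by
      simp [VectorField.lieBracket]] at h2
  simpa [sub_eq_zero] using h2

variable [InnerProductSpace ℝ F] [FiniteDimensional ℝ F]

/-- Around every point of a Kenmotsu manifold there are coordinates `(t, v)` with `ξ = ∂/∂t` and
`η = dt`: the closed form `η` has a local primitive, which grows at unit speed along `ξ`. -/
theorem exists_isAdapted (h : IsKenmotsu g φ ξ η) (p : M)
    (hF : Module.finrank ℝ F + 1 = Module.finrank ℝ E) :
    ∃ (ε : ℝ) (Φ : PartialDiffeomorph 𝓘(ℝ, ℝ × F) 𝓘(ℝ, E) (ℝ × F) M ∞),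
      IsAdapted ξ η ε Φ ∧ p ∈ Φ.target := by
  let C : PartialDiffeomorph 𝓘(ℝ, E) 𝓘(ℝ, E) E M ∞ := chartSymm p
  let y₀ : E := extChartAt 𝓘(ℝ, E) p p
  have hy₀ : y₀ ∈ C.source := mem_extChartAt_target (I := 𝓘(ℝ, E)) p
  have hCy₀ : C y₀ = p := extChartAt_to_inv (I := 𝓘(ℝ, E)) p
  obtain ⟨R, hR, hRC⟩ := Metric.isOpen_iff.1 C.open_source _ hy₀
  let θ := pullForm C η
  have hθ : ContDiffOn ℝ ∞ θ (Metric.ball y₀ R) :=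
    (contDiffOn_pullForm h.toIsAlmostContactMetric C).mono hRC
  obtain ⟨f₀, hf₀⟩ := (convex_ball y₀ R).exists_forall_hasFDerivAt_of_fderiv_symmetric
    Metric.isOpen_ball (hθ.differentiableOn (by simp))
    (fun y hy a b ↦ fderiv_pullForm_symm h C (hRC hy) a b)
  let f : E → ℝ := fun y ↦ f₀ y - f₀ y₀
  have hf : ∀ y ∈ Metric.ball y₀ R, HasFDerivAt f (θ y) y := fun y hy ↦ (hf₀ y hy).sub_const _
  have hfc : ContDiffOn ℝ ∞ f (Metric.ball y₀ R) := by
    rw [contDiffOn_infty_iff_fderiv_of_isOpen Metric.isOpen_ball]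
    exact ⟨fun y hy ↦ (hf y hy).differentiableAt.differentiableWithinAt,
      hθ.congr fun y hy ↦ (hf y hy).fderiv⟩
  let X : E → E := pull C ξ
  have hX : ContDiffOn ℝ ∞ X (Metric.ball y₀ R) := fun y hy ↦
    (contDiffAt_pull C (hRC hy) (h.smooth_xi.contMDiffAt Filter.univ_mem)).contDiffWithinAt
  have hdX : ∀ y ∈ C.source, differential C y (X y) = ξ (C y) := fun y hy ↦ by
    rw [show X y = _ from pull_apply C hy ξ, differential_codifferential C hy]
  have hθX : ∀ y ∈ C.source, θ y (X y) = 1 := fun y hy ↦ by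
    change η (C y) (differential C y (X y)) = 1
    rw [hdX y hy, h.eta_xi]
  -- `F` parametrizes the kernel of `η` at `p`, which is transverse to `ξ`
  let K : Submodule ℝ E := LinearMap.ker (θ y₀ : E →ₗ[ℝ] ℝ)
  have hK : Module.finrank ℝ F = Module.finrank ℝ K := by
    have h1 := LinearMap.finrank_range_add_finrank_ker (θ y₀ : E →ₗ[ℝ] ℝ)
    have h2 : LinearMap.range (θ y₀ : E →ₗ[ℝ] ℝ) = ⊤ := by
      refine LinearMap.range_eq_top.2 fun s ↦ ⟨s • X y₀, ?_⟩
      simp [hθX y₀ hy₀]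
    rw [h2, finrank_top, Module.finrank_self] at h1
    change _ = Module.finrank ℝ (LinearMap.ker (θ y₀ : E →ₗ[ℝ] ℝ))
    omega
  let κ : F →L[ℝ] E := K.subtypeL.comp (ContinuousLinearEquiv.ofFinrankEq hK : F →L[ℝ] K)
  have hθκ : ∀ w, θ y₀ (κ w) = 0 := fun w ↦ (ContinuousLinearEquiv.ofFinrankEq hK w).2
  have hκ0 : ∀ w, κ w = 0 → w = 0 := fun w hw ↦ by
    have : ContinuousLinearEquiv.ofFinrankEq hK w = 0 := Subtype.ext hw
    simpa using this
  let L₀ : ℝ × F →ₗ[ℝ] E :=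
    (((ContinuousLinearMap.fst ℝ ℝ F).smulRight (X y₀)
      + κ.comp (ContinuousLinearMap.snd ℝ ℝ F) : ℝ × F →L[ℝ] E) : ℝ × F →ₗ[ℝ] E)
  have hL₀ : ∀ s w, L₀ (s, w) = s • X y₀ + κ w := fun s w ↦ by simp [L₀]
  have hL₀i : Function.Injective L₀ := by
    rw [injective_iff_map_eq_zero]
    rintro ⟨s, w⟩ hsw
    rw [hL₀] at hsw
    have h1 : s = 0 := by simpa [hθX y₀ hy₀, hθκ] using congrArg (θ y₀) hsw
    rw [h1, zero_smul, zero_add] at hsw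
    rw [h1, hκ0 w hsw, Prod.mk_zero_zero]
  let L : (ℝ × F) ≃L[ℝ] E := (LinearEquiv.ofInjectiveOfFinrankEq L₀ hL₀i (by
    rw [Module.finrank_prod, Module.finrank_self, ← hF, add_comm])).toContinuousLinearEquiv
  have hb₀ : y₀ ∈ Metric.ball y₀ R := Metric.mem_ball_self hR
  obtain ⟨ε, Ψ, hε, hΨs, hΨt, hΨ0, hΨc, hΨsc, hΨX, hΨf⟩ := exists_flowBox
    Metric.isOpen_ball hb₀ hX hfc (sub_self _)
    (fun y hy ↦ by rw [(hf y hy).fderiv]; exact hθX y (hRC hy))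
    (κ := κ) (fun w ↦ by rw [(hf y₀ hb₀).fderiv]; exact hθκ w) L (fun s w ↦ hL₀ s w)
  let Ψ' : PartialDiffeomorph 𝓘(ℝ, ℝ × F) 𝓘(ℝ, E) (ℝ × F) E ∞ :=
    { toPartialEquiv := Ψ.toPartialEquiv
      open_source := Ψ.open_source
      open_target := Ψ.open_target
      contMDiffOn_toFun := hΨc.contMDiffOn
      contMDiffOn_invFun := hΨsc.contMDiffOn }
  let Φ := Ψ'.trans C
  have hsub : ∀ q ∈ Ψ.source, Ψ q ∈ Metric.ball y₀ R := fun q hq ↦ hΨt (Ψ.map_source hq)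
  have hΦs : Φ.source = Ψ.source := by
    change Ψ.source ∩ Ψ ⁻¹' C.source = Ψ.source
    exact inter_eq_left.2 fun q hq ↦ hRC (hsub q hq)
  have hΨd : ∀ q ∈ Ψ.source, HasFDerivAt Ψ (fderiv ℝ Ψ q) q := fun q hq ↦
    ((hΨc.contDiffAt (Ψ.open_source.mem_nhds hq)).differentiableAt (by simp)).hasFDerivAt
  have hΦd : ∀ q ∈ Ψ.source, ∀ a, differential Φ q a = differential C (Ψ q) (fderiv ℝ Ψ q a) := by
    intro q hq a
    have h1 := mfderiv_comp_apply (I := 𝓘(ℝ, ℝ × F)) (I' := 𝓘(ℝ, E)) (I'' := 𝓘(ℝ, E)) (g := C)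
      (f := Ψ) q ((contMDiffAt_apply C (hRC (hsub q hq))).mdifferentiableAt (by simp))
      (hΨd q hq).differentiableAt.mdifferentiableAt a
    rw [mfderiv_eq_fderiv] at h1
    exact h1
  refine ⟨ε, Φ, ⟨hε, hΦs.trans hΨs, ?_, ?_⟩, ?_⟩
  · intro q hq
    rw [hΦs] at hq
    have h1 : HasDerivAt (fun t ↦ Ψ (t, q.2)) (fderiv ℝ Ψ q (1, 0)) q.1 :=
      HasFDerivAt.comp_hasDerivAt (l := Ψ) q.1 (hΨd q hq)
        ((hasDerivAt_id q.1).prodMk (hasDerivAt_const _ _))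
    rw [hΦd q hq, h1.unique (hΨX q hq)]
    exact hdX _ (hRC (hsub q hq))
  · intro q hq a
    rw [hΦs] at hq
    rw [hΦd q hq]
    have h1 : HasFDerivAt (f ∘ Ψ) _ q := (hf _ (hsub q hq)).comp q (hΨd q hq)
    have h2 : HasFDerivAt (f ∘ Ψ) (ContinuousLinearMap.fst ℝ ℝ F) q :=
      hasFDerivAt_fst.congr_of_eventuallyEq (by
        filter_upwards [Ψ.open_source.mem_nhds hq] with x hx using hΨf x hx)
    exact DFunLike.congr_fun (h1.unique h2) a
  · change p ∈ C.target ∩ C.symm ⁻¹' Ψ.target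
    refine ⟨hCy₀ ▸ C.map_source hy₀, ?_⟩
    rw [mem_preimage, ← hCy₀, symm_apply_apply C hy₀]
    exact hΨ0

end AdaptedChart

/-! ### Tensor fields on a vector space -/

section VectorSpace

variable {W : Type*} [NormedAddCommGroup W] [NormedSpace ℝ W]

theorem smoothEnd_of_contDiff {A : W → W →L[ℝ] W} (hA : ContDiff ℝ ∞ A) :
    SmoothEnd (M := W) (E := W) A univ := by
  intro x _
  rw [contMDiffWithinAt_univ, contMDiffAt_hom_bundle]
  refine ⟨contMDiffAt_id, ?_⟩
  simp only [inCoordinates_tangent_bundle_core_model_space]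
  exact hA.contDiffAt.contMDiffAt

theorem contMDiff_of_contDiff_bilin {B : W → W →L[ℝ] W →L[ℝ] ℝ} (hB : ContDiff ℝ ∞ B) :
    ContMDiff 𝓘(ℝ, W) (𝓘(ℝ, W).prod 𝓘(ℝ, W →L[ℝ] W →L[ℝ] ℝ)) ∞
      (fun x ↦ TotalSpace.mk' (W →L[ℝ] W →L[ℝ] ℝ)
        (E := fun x : W ↦ TangentSpace 𝓘(ℝ, W) x →L[ℝ] TangentSpace 𝓘(ℝ, W) x →L[ℝ] ℝ)
        x (B x)) := by
  intro x
  rw [contMDiffAt_hom_bundle]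
  refine ⟨contMDiffAt_id, ?_⟩
  refine hB.contDiffAt.contMDiffAt.congr_of_eventuallyEq (Filter.Eventually.of_forall fun y ↦ ?_)
  have hy : y ∈ (trivializationAt W (TangentSpace 𝓘(ℝ, W)) x).baseSet := by
    rw [TangentBundle.trivializationAt_baseSet, chartAt_self_eq]
    exact mem_univ y
  have h : ∀ a : W, (trivializationAt W (TangentSpace 𝓘(ℝ, W)) x).symm y a = a := fun a ↦
    (Trivialization.symmL_apply (R := ℝ) _ hy a).symm.trans
      (DFunLike.congr_fun (F := W →L[ℝ] W) (TangentBundle.symmL_model_space (𝕜 := ℝ) x y) a)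
  ext a b
  refine (inCoordinates_apply_eq₂ (E₃ := fun _ : W ↦ ℝ) (F₃ := ℝ)
    hy hy (mem_univ _)).trans ?_
  rw [h, h]
  simp
  rfl

/-- A positive definite form on a finite-dimensional space is comparable with the norm. -/
theorem isVonNBounded_of_pos [FiniteDimensional ℝ W] (B : W →L[ℝ] W →L[ℝ] ℝ)
    (hB : ∀ v, v ≠ 0 → 0 < B v v) : Bornology.IsVonNBounded ℝ {v | B v v < 1} := by
  have hc : Continuous fun v ↦ B v v := B.continuous.clm_apply continuous_id
  obtain ⟨c, hc0, hcB⟩ : ∃ c : ℝ, 0 < c ∧ ∀ v, ‖v‖ = 1 → c ≤ B v v := by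
    have : ProperSpace W := FiniteDimensional.proper ℝ W
    rcases (Metric.sphere (0 : W) 1).eq_empty_or_nonempty with h | h
    · refine ⟨1, one_pos, fun v hv ↦ ?_⟩
      have : v ∈ Metric.sphere (0 : W) 1 := by simpa using hv
      rw [h] at this
      exact this.elim
    · obtain ⟨w, hw, hmin⟩ := (isCompact_sphere (0 : W) 1).exists_isMinOn h hc.continuousOn
      refine ⟨B w w, hB w ?_, fun v hv ↦ hmin (by simpa using hv)⟩
      rintro rfl
      simp at hw
  rw [NormedSpace.isVonNBounded_iff, isBounded_iff_forall_norm_le]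
  refine ⟨Real.sqrt (1 / c), fun v (hv : B v v < 1) ↦ ?_⟩
  rcases eq_or_ne v 0 with rfl | h0
  · simp
  have hn : 0 < ‖v‖ := norm_pos_iff.2 h0
  have h1 := hcB (‖v‖⁻¹ • v) (by rw [norm_smul, norm_inv, norm_norm, inv_mul_cancel₀ hn.ne'])
  simp only [map_smul, smul_apply, smul_eq_mul] at h1
  refine Real.le_sqrt_of_sq_le ?_
  rw [le_div_iff₀ hc0]
  have h2 : c * ‖v‖ ^ 2 ≤ B v v := by
    calc c * ‖v‖ ^ 2 ≤ (‖v‖⁻¹ * (‖v‖⁻¹ * B v v)) * ‖v‖ ^ 2 := by gcongr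
      _ = B v v := by field_simp
  linarith

/-- The Riemannian metric on a vector space given by a smooth family of positive definite forms. -/
def metricOfContDiff [FiniteDimensional ℝ W] (B : W → W →L[ℝ] W →L[ℝ] ℝ) (hB : ContDiff ℝ ∞ B)
    (hsymm : ∀ v a b, B v a b = B v b a) (hpos : ∀ v a, a ≠ 0 → 0 < B v a a) : Metric W W where
  inner v := B v
  symm := hsymm
  pos := hpos
  isVonNBounded v := isVonNBounded_of_pos (B v) (hpos v)
  contMDiff := contMDiff_of_contDiff_bilin hB

end VectorSpace

/-! ### Pullback of tensor fields by partial diffeomorphisms -/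

section Pullback

variable {W : Type*} [NormedAddCommGroup W] [NormedSpace ℝ W]
  {E : Type*} [NormedAddCommGroup E] [NormedSpace ℝ E]
  {M : Type*} [TopologicalSpace M] [ChartedSpace E M]
  (Φ : PartialDiffeomorph 𝓘(ℝ, W) 𝓘(ℝ, E) W M ∞) {q : W}

/-- The pullback of the endomorphism field `A` by `Φ`. -/
def pullEnd (A : Π x : M, TangentSpace 𝓘(ℝ, E) x →L[ℝ] TangentSpace 𝓘(ℝ, E) x) (q : W) :
    W →L[ℝ] W :=
  (codifferential Φ (Φ q)).comp ((A (Φ q)).comp (differential Φ q))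

variable {A : Π x : M, TangentSpace 𝓘(ℝ, E) x →L[ℝ] TangentSpace 𝓘(ℝ, E) x}

theorem differential_pullEnd (hq : q ∈ Φ.source) (a : W) :
    differential Φ q (pullEnd Φ A q a) = A (Φ q) (differential Φ q a) :=
  differential_codifferential Φ hq _

theorem injective_differential (hq : q ∈ Φ.source) : Function.Injective (differential Φ q) :=
  (tangentEquiv Φ hq).injective

variable [FiniteDimensional ℝ W] [IsManifold 𝓘(ℝ, E) ∞ M]

/-- The pullback of the Riemannian metric `g` by `Φ`. -/
def pullMetric (g : Metric E M) (q : W) : W →L[ℝ] W →L[ℝ] ℝ :=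
  LinearMap.toContinuousLinearMap
    { toFun := fun a ↦ (g.inner (Φ q) (differential Φ q a)).comp (differential Φ q)
      map_add' := fun a b ↦ by ext; simp
      map_smul' := fun c a ↦ by ext; simp }

theorem pullMetric_apply (g : Metric E M) (q a b : W) :
    pullMetric Φ g q a b = g.inner (Φ q) (differential Φ q a) (differential Φ q b) := rfl

variable [CompleteSpace E]

theorem contDiffAt_pullMetric (g : Metric E M) (hq : q ∈ Φ.source) :
    ContDiffAt ℝ ∞ (pullMetric Φ g) q := by
  have : ContDiffOn ℝ ∞ (pullMetric Φ g) Φ.source := by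
    rw [contDiffOn_clm_apply]
    intro a
    rw [contDiffOn_clm_apply]
    intro b q hq
    have h1 : CMDiffAt ∞ (fun y ↦ g.inner y (push Φ (fun _ ↦ a) y) (push Φ (fun _ ↦ b) y)) (Φ q) :=
      contMDiffAt_inner g (contMDiffAt_push Φ hq contDiffAt_const)
        (contMDiffAt_push Φ hq contDiffAt_const)
    refine ((contDiffAt_comp Φ hq h1).congr_of_eventuallyEq ?_).contDiffWithinAt
    filter_upwards [Φ.open_source.mem_nhds hq] with x hx
    rw [push_apply Φ hx, push_apply Φ hx]
    rfl
  exact this.contDiffAt (Φ.open_source.mem_nhds hq)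

theorem contDiffAt_pullEnd (hA : SmoothEnd A univ) (hq : q ∈ Φ.source) :
    ContDiffAt ℝ ∞ (pullEnd Φ A) q := by
  have hW : CompleteSpace W := FiniteDimensional.complete ℝ W
  have : ContDiffOn ℝ ∞ (pullEnd Φ A) Φ.source := by
    rw [contDiffOn_clm_apply]
    intro a q hq
    have h1 : CMDiffAt ∞ (T% (fun y ↦ A y (push Φ (fun _ ↦ a) y))) (Φ q) :=
      contMDiffAt_end_apply isOpen_univ hA (mem_univ _) (contMDiffAt_push Φ hq contDiffAt_const)
    refine ((contDiffAt_pull Φ hq h1).congr_of_eventuallyEq ?_).contDiffWithinAt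
    filter_upwards [Φ.open_source.mem_nhds hq] with x hx
    rw [pull_apply Φ hx, push_apply Φ hx]
    rfl
  exact this.contDiffAt (Φ.open_source.mem_nhds hq)

end Pullback

theorem mlieBracket_congr {E : Type*} [NormedAddCommGroup E] [NormedSpace ℝ E]
    {M : Type*} [TopologicalSpace M] [ChartedSpace E M] {x : M}
    {X X' Y Y' : Π x : M, TangentSpace 𝓘(ℝ, E) x} (hX : X' =ᶠ[𝓝 x] X) (hY : Y' =ᶠ[𝓝 x] Y) :
    VectorField.mlieBracket 𝓘(ℝ, E) X' Y' x = VectorField.mlieBracket 𝓘(ℝ, E) X Y x :=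
  hX.mlieBracket_vectorField_eq hY

/-! ### The flow of `ξ` in adapted coordinates -/

/-- A function on a cylinder with vanishing derivative along the axis is determined by its values
on the central slice. -/
theorem eq_slice_of_fderiv_eq_zero {F G : Type*} [NormedAddCommGroup F] [NormedSpace ℝ F]
    [NormedAddCommGroup G] [NormedSpace ℝ G] {ε : ℝ} {u : ℝ × F → G}
    (hd : ∀ q ∈ Ioo (-ε) ε ×ˢ (univ : Set F), DifferentiableAt ℝ u q)
    (h0 : ∀ q ∈ Ioo (-ε) ε ×ˢ (univ : Set F), fderiv ℝ u q (1, 0) = 0) {t : ℝ}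
    (ht : t ∈ Ioo (-ε) ε) (v : F) : u (t, v) = u (0, v) := by
  have h1 : ∀ s ∈ Ioo (-ε) ε, HasDerivAt (fun s ↦ u (s, v)) 0 s := by
    intro s hs
    have hmem : (s, v) ∈ Ioo (-ε) ε ×ˢ (univ : Set F) := ⟨hs, mem_univ _⟩
    have h2 : HasDerivAt (fun s : ℝ ↦ (s, v)) ((1 : ℝ), (0 : F)) s :=
      (hasDerivAt_id s).prodMk (hasDerivAt_const s v)
    have h3 := (hd _ hmem).hasFDerivAt.comp_hasDerivAt s h2
    rwa [h0 _ hmem] at h3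
  have h0' : (0 : ℝ) ∈ Ioo (-ε) ε := ⟨by linarith [ht.1, ht.2], by linarith [ht.1, ht.2]⟩
  exact isOpen_Ioo.is_const_of_deriv_eq_zero isPreconnected_Ioo
    (fun s hs ↦ (h1 s hs).differentiableAt.differentiableWithinAt)
    (fun s hs ↦ (h1 s hs).deriv) ht h0'

section Leaf

variable {E : Type*} [NormedAddCommGroup E] [NormedSpace ℝ E]
  {M : Type*} [TopologicalSpace M] [ChartedSpace E M]
  {F : Type*} [NormedAddCommGroup F] [NormedSpace ℝ F]
  {ξ : Π x : M, TangentSpace 𝓘(ℝ, E) x} {η : Π x : M, TangentSpace 𝓘(ℝ, E) x →L[ℝ] ℝ} {ε : ℝ}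
  {Φ : PartialDiffeomorph 𝓘(ℝ, ℝ × F) 𝓘(ℝ, E) (ℝ × F) M ∞} {q : ℝ × F}

namespace IsAdapted

theorem mem_source (h : IsAdapted ξ η ε Φ) {t : ℝ} (ht : t ∈ Ioo (-ε) ε) (v : F) :
    (t, v) ∈ Φ.source := by
  rw [h.source_eq]
  exact ⟨ht, mem_univ _⟩

theorem zero_mem_Ioo (h : IsAdapted ξ η ε Φ) : (0 : ℝ) ∈ Ioo (-ε) ε :=
  ⟨neg_lt_zero.2 h.pos, h.pos⟩

theorem zero_mem_source (h : IsAdapted ξ η ε Φ) (v : F) : ((0 : ℝ), v) ∈ Φ.source :=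
  h.mem_source h.zero_mem_Ioo v

theorem eq_of_differential_eq (h : IsAdapted ξ η ε Φ) {v a b : F}
    (hab : differential Φ (0, v) (0, a) = differential Φ (0, v) (0, b)) : a = b :=
  congrArg Prod.snd (injective_differential Φ (h.zero_mem_source v) hab)

theorem xi_eventuallyEq (h : IsAdapted ξ η ε Φ) (hq : q ∈ Φ.source) :
    ξ =ᶠ[𝓝 (Φ q)] push Φ (fun _ ↦ (1, 0)) :=
  eventually_target Φ hq fun x hx ↦ by rw [push_apply Φ hx, h.differential_fst x hx]

variable [IsManifold 𝓘(ℝ, E) ∞ M] [FiniteDimensional ℝ E] {g : Metric E M}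
  {φ : Π x : M, TangentSpace 𝓘(ℝ, E) x →L[ℝ] TangentSpace 𝓘(ℝ, E) x}

/-- In adapted coordinates, the bracket with `ξ` is the derivative in the direction of `t`. -/
theorem mlieBracket_xi_push (h : IsAdapted ξ η ε Φ) (hq : q ∈ Φ.source) {X : ℝ × F → ℝ × F}
    (hX : DifferentiableAt ℝ X q) :
    VectorField.mlieBracket 𝓘(ℝ, E) ξ (push Φ X) (Φ q)
      = differential Φ q (fderiv ℝ X q (1, 0)) := by
  have : CompleteSpace E := FiniteDimensional.complete ℝ E
  have h1 := (mlieBracket_congr (h.xi_eventuallyEq hq)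
    (Filter.EventuallyEq.refl _ (push Φ X))).trans
      (mlieBracket_push Φ hq (differentiableAt_const _) hX)
  rw [h1]
  simp [VectorField.lieBracket]

variable [FiniteDimensional ℝ F]

theorem fderiv_pullMetric (h : IsAdapted ξ η ε Φ) (hK : IsKenmotsu g φ ξ η) (hq : q ∈ Φ.source)
    (a b : F) :
    fderiv ℝ (fun x ↦ pullMetric Φ g x (0, a) (0, b)) q (1, 0)
      = 2 * pullMetric Φ g q (0, a) (0, b) := by
  have : CompleteSpace E := FiniteDimensional.complete ℝ E
  have hp : ∀ c : ℝ × F, MDiffAt (T% (push Φ (fun _ ↦ c))) (Φ q) := fun c ↦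
    mdifferentiableAt_push Φ hq (differentiableAt_const c)
  have h1 := hK.mvfderiv_inner_xi (hp (0, a)) (hp (0, b))
  rw [h.mlieBracket_xi_push hq (differentiableAt_const _),
    h.mlieBracket_xi_push hq (differentiableAt_const _), push_apply Φ hq, push_apply Φ hq,
    h.eta_differential q hq, h.eta_differential q hq, ← h.differential_fst q hq,
    mvfderiv_differential Φ hq (mdifferentiableAt_inner (hp _) (hp _))] at h1
  have h2 : (fun x ↦ pullMetric Φ g x (0, a) (0, b)) =ᶠ[𝓝 q] fun x ↦
      g.inner (Φ x) (push Φ (fun _ ↦ (0, a)) (Φ x)) (push Φ (fun _ ↦ (0, b)) (Φ x)) := by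
    filter_upwards [Φ.open_source.mem_nhds hq] with x hx
    rw [push_apply Φ hx, push_apply Φ hx]
    rfl
  rw [h2.fderiv_eq, h1]
  simp [pullMetric_apply]

/-- The flow of `ξ` rescales the metric on the leaves exponentially. -/
theorem pullMetric_eq (h : IsAdapted ξ η ε Φ) (hK : IsKenmotsu g φ ξ η) {t : ℝ}
    (ht : t ∈ Ioo (-ε) ε) (v a b : F) :
    pullMetric Φ g (t, v) (0, a) (0, b)
      = Real.exp t ^ 2 * pullMetric Φ g (0, v) (0, a) (0, b) := by
  have : CompleteSpace E := FiniteDimensional.complete ℝ E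
  have hd : ∀ q ∈ Ioo (-ε) ε ×ˢ (univ : Set F),
      HasFDerivAt (fun x : ℝ × F ↦ pullMetric Φ g x (0, a) (0, b))
        (fderiv ℝ (fun x ↦ pullMetric Φ g x (0, a) (0, b)) q) q := fun q hq ↦ by
    rw [← h.source_eq] at hq
    have := (contDiffAt_pullMetric Φ g hq).differentiableAt (by simp)
    exact (((this.clm_apply (differentiableAt_const _)).clm_apply
      (differentiableAt_const _))).hasFDerivAt
  have he : ∀ q : ℝ × F, HasFDerivAt (fun x : ℝ × F ↦ Real.exp (-2 * x.1))
      (Real.exp (-2 * q.1) • ((-2 : ℝ) • ContinuousLinearMap.fst ℝ ℝ F)) q := fun q ↦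
    (hasFDerivAt_fst.const_mul (-2 : ℝ)).exp
  -- `e^{-2t} g` is constant along the flow
  have key := eq_slice_of_fderiv_eq_zero (u := fun x : ℝ × F ↦
      Real.exp (-2 * x.1) * pullMetric Φ g x (0, a) (0, b))
    (fun q hq ↦ ((he q).mul (hd q hq)).differentiableAt) (fun q hq ↦ by
      refine (DFunLike.congr_fun ((he q).mul (hd q hq)).fderiv _).trans ?_
      rw [← h.source_eq] at hq
      simp only [add_apply, smul_apply, h.fderiv_pullMetric hK hq, smul_eq_mul,
        ContinuousLinearMap.coe_fst']
      ring) ht v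
  simp only [mul_zero, Real.exp_zero, one_mul] at key
  rw [← key, ← mul_assoc, ← Real.exp_nat_mul, ← Real.exp_add]
  simp

/-- The flow of `ξ` preserves `φ`, which is therefore independent of `t`. -/
theorem pullEnd_eq (h : IsAdapted ξ η ε Φ) (hK : IsKenmotsu g φ ξ η) {t : ℝ}
    (ht : t ∈ Ioo (-ε) ε) (v a : F) :
    pullEnd Φ φ (t, v) (0, a) = pullEnd Φ φ (0, v) (0, a) := by
  have : CompleteSpace E := FiniteDimensional.complete ℝ E
  have hd : ∀ q ∈ Ioo (-ε) ε ×ˢ (univ : Set F),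
      DifferentiableAt ℝ (fun x : ℝ × F ↦ pullEnd Φ φ x (0, a)) q := fun q hq ↦ by
    rw [← h.source_eq] at hq
    exact ((contDiffAt_pullEnd Φ hK.smooth_phi hq).differentiableAt (by simp)).clm_apply
      (differentiableAt_const _)
  refine eq_slice_of_fderiv_eq_zero hd (fun q hq ↦ ?_) ht v
  have hdq := hd q hq
  rw [← h.source_eq] at hq
  have h1 := hK.mlieBracket_xi_phi
    (mdifferentiableAt_push Φ hq (differentiableAt_const ((0 : ℝ), a)))
  have h2 : (fun y ↦ φ y (push Φ (fun _ ↦ (0, a)) y))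
      =ᶠ[𝓝 (Φ q)] push Φ (fun x ↦ pullEnd Φ φ x (0, a)) :=
    eventually_target Φ hq fun x hx ↦
      (congrArg (φ (Φ x)) (push_apply Φ hx _)).trans
        ((differential_pullEnd Φ hx _).symm.trans (push_apply Φ hx fun x ↦ pullEnd Φ φ x (0, a)).symm)
  have h3 := (mlieBracket_congr (Filter.EventuallyEq.refl _ ξ) h2).trans
    (h.mlieBracket_xi_push hq hdq)
  rw [h.mlieBracket_xi_push hq (differentiableAt_const _)] at h1
  refine injective_differential Φ hq (h3.symm.trans (h1.trans ?_))
  simp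

end IsAdapted

end Leaf

/-! ### The geometry of a leaf -/

section Leaf

variable {E : Type*} [NormedAddCommGroup E] [NormedSpace ℝ E] [FiniteDimensional ℝ E]
  {M : Type*} [TopologicalSpace M] [ChartedSpace E M] [IsManifold 𝓘(ℝ, E) ∞ M]
  {F : Type*} [NormedAddCommGroup F] [NormedSpace ℝ F] [FiniteDimensional ℝ F]
  {g : Metric E M} {φ : Π x : M, TangentSpace 𝓘(ℝ, E) x →L[ℝ] TangentSpace 𝓘(ℝ, E) x}
  {ξ : Π x : M, TangentSpace 𝓘(ℝ, E) x} {η : Π x : M, TangentSpace 𝓘(ℝ, E) x →L[ℝ] ℝ} {ε : ℝ}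
  {Φ : PartialDiffeomorph 𝓘(ℝ, ℝ × F) 𝓘(ℝ, E) (ℝ × F) M ∞}

namespace IsAdapted

variable (g) in
/-- The metric induced on the leaf `{t = 0}`, which is identified with `F`. -/
def leafMetric (h : IsAdapted ξ η ε Φ) : Metric F F :=
  metricOfContDiff
    (fun v ↦ (pullMetric Φ g (0, v)).bilinearComp
      (ContinuousLinearMap.inr ℝ ℝ F) (ContinuousLinearMap.inr ℝ ℝ F))
    (by
      have : CompleteSpace E := FiniteDimensional.complete ℝ E
      rw [contDiff_clm_apply_iff]
      intro a
      rw [contDiff_clm_apply_iff]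
      intro b
      rw [contDiff_iff_contDiffAt]
      intro v
      have h1 := contDiffAt_pullMetric Φ g (h.zero_mem_source v)
      exact ((h1.comp v (contDiff_prodMk_right (0 : ℝ)).contDiffAt).clm_apply
        contDiffAt_const).clm_apply contDiffAt_const)
    (fun v a b ↦ g.symm _ _ _)
    (fun v a ha ↦ g.pos _ _ fun h0 ↦ ha (by
      have h1 := injective_differential Φ (h.zero_mem_source v)
        (h0.trans (map_zero (differential Φ ((0 : ℝ), v))).symm)
      exact congrArg Prod.snd h1))

theorem leafMetric_inner (h : IsAdapted ξ η ε Φ) (v a b : F) :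
    (h.leafMetric g).inner v a b = pullMetric Φ g (0, v) (0, a) (0, b) := rfl

end IsAdapted

/-- The endomorphism field induced by `φ` on the leaf `{t = 0}`. -/
def leafEnd (Φ : PartialDiffeomorph 𝓘(ℝ, ℝ × F) 𝓘(ℝ, E) (ℝ × F) M ∞)
    (φ : Π x : M, TangentSpace 𝓘(ℝ, E) x →L[ℝ] TangentSpace 𝓘(ℝ, E) x) (v : F) : F →L[ℝ] F :=
  (ContinuousLinearMap.snd ℝ ℝ F).comp ((pullEnd Φ φ (0, v)).comp (ContinuousLinearMap.inr ℝ ℝ F))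

end Leaf

section Lift

variable {E : Type*} [NormedAddCommGroup E] [NormedSpace ℝ E]
  {M : Type*} [TopologicalSpace M] [ChartedSpace E M]
  {F : Type*} [NormedAddCommGroup F] [NormedSpace ℝ F]
  {Φ : PartialDiffeomorph 𝓘(ℝ, ℝ × F) 𝓘(ℝ, E) (ℝ × F) M ∞} {q : ℝ × F}

/-- The field on the target of `Φ` that is tangent to the leaves, and agrees on each of them with
the field `X`. -/
def lift (Φ : PartialDiffeomorph 𝓘(ℝ, ℝ × F) 𝓘(ℝ, E) (ℝ × F) M ∞) (X : F → F) :
    Π y : M, TangentSpace 𝓘(ℝ, E) y :=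
  push Φ fun q ↦ (0, X q.2)

theorem lift_apply (hq : q ∈ Φ.source) (X : F → F) :
    lift Φ X (Φ q) = differential Φ q (0, X q.2) := push_apply Φ hq _

variable [IsManifold 𝓘(ℝ, E) ∞ M] [FiniteDimensional ℝ E]

theorem mdifferentiableAt_lift (hq : q ∈ Φ.source) {X : F → F} (hX : DifferentiableAt ℝ X q.2) :
    MDiffAt (T% (lift Φ X)) (Φ q) := by
  have : CompleteSpace E := FiniteDimensional.complete ℝ E
  exact mdifferentiableAt_push Φ hq
    ((differentiableAt_const _).prodMk (hX.comp q differentiableAt_snd))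

theorem mlieBracket_lift (hq : q ∈ Φ.source) {X Y : F → F} (hX : DifferentiableAt ℝ X q.2)
    (hY : DifferentiableAt ℝ Y q.2) :
    VectorField.mlieBracket 𝓘(ℝ, E) (lift Φ X) (lift Φ Y) (Φ q)
      = differential Φ q (0, VectorField.lieBracket ℝ X Y q.2) := by
  have : CompleteSpace E := FiniteDimensional.complete ℝ E
  have hd : ∀ {Z : F → F}, DifferentiableAt ℝ Z q.2 →
      HasFDerivAt (fun x : ℝ × F ↦ ((0 : ℝ), Z x.2))
        ((0 : ℝ × F →L[ℝ] ℝ).prod ((fderiv ℝ Z q.2).comp (ContinuousLinearMap.snd ℝ ℝ F))) q :=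
    fun hZ ↦ (hasFDerivAt_const _ _).prodMk (hZ.hasFDerivAt.comp q hasFDerivAt_snd)
  refine (mlieBracket_push Φ hq (hd hX).differentiableAt (hd hY).differentiableAt).trans ?_
  congr 1
  rw [VectorField.lieBracket, VectorField.lieBracket, (hd hX).fderiv, (hd hY).fderiv]
  simp

end Lift

section Leaf

variable {E : Type*} [NormedAddCommGroup E] [NormedSpace ℝ E] [FiniteDimensional ℝ E]
  {M : Type*} [TopologicalSpace M] [ChartedSpace E M] [IsManifold 𝓘(ℝ, E) ∞ M]
  {F : Type*} [NormedAddCommGroup F] [NormedSpace ℝ F] [FiniteDimensional ℝ F]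
  {g : Metric E M} {φ : Π x : M, TangentSpace 𝓘(ℝ, E) x →L[ℝ] TangentSpace 𝓘(ℝ, E) x}
  {ξ : Π x : M, TangentSpace 𝓘(ℝ, E) x} {η : Π x : M, TangentSpace 𝓘(ℝ, E) x →L[ℝ] ℝ} {ε : ℝ}
  {Φ : PartialDiffeomorph 𝓘(ℝ, ℝ × F) 𝓘(ℝ, E) (ℝ × F) M ∞}

namespace IsAdapted

theorem mvfderiv_inner_lift (h : IsAdapted ξ η ε Φ) {v : F} {Y Z : F → F}
    (hY : DifferentiableAt ℝ Y v) (hZ : DifferentiableAt ℝ Z v) (a : F) :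
    mvfderiv 𝓘(ℝ, E) (fun y ↦ g.inner y (lift Φ Y y) (lift Φ Z y)) (Φ (0, v))
        (differential Φ (0, v) (0, a))
      = fderiv ℝ (fun w ↦ pullMetric Φ g (0, w) (0, Y w) (0, Z w)) v a := by
  have hq := h.zero_mem_source v
  have hd := mdifferentiableAt_inner (g := g) (mdifferentiableAt_lift (Φ := Φ) hq hY)
    (mdifferentiableAt_lift hq hZ)
  rw [mvfderiv_differential Φ hq hd]
  have h1 : HasFDerivAt (fun w : F ↦ ((0 : ℝ), w)) (ContinuousLinearMap.inr ℝ ℝ F) v :=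
    hasFDerivAt_prodMk_right 0 v
  have h2 := (differentiableAt_comp Φ hq hd).hasFDerivAt.comp v h1
  have h3 : (fun w ↦ pullMetric Φ g (0, w) (0, Y w) (0, Z w))
      = (fun x ↦ g.inner (Φ x) (lift Φ Y (Φ x)) (lift Φ Z (Φ x))) ∘ fun w : F ↦ ((0 : ℝ), w) := by
    ext w
    simp only [Function.comp_apply]
    rw [lift_apply (h.zero_mem_source w), lift_apply (h.zero_mem_source w)]
    rfl
  rw [h3, h2.fderiv]
  rfl

/-- All the terms of the Koszul formula on a leaf involve only derivatives along the leaf. -/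
theorem koszul_leafMetric (h : IsAdapted ξ η ε Φ) {v : F} {X Y Z : F → F}
    (hX : DifferentiableAt ℝ X v) (hY : DifferentiableAt ℝ Y v) (hZ : DifferentiableAt ℝ Z v) :
    koszul (h.leafMetric g) (asField X) (asField Y) (asField Z) v
      = koszul g (lift Φ X) (lift Φ Y) (lift Φ Z) (Φ (0, v)) := by
  have hq := h.zero_mem_source v
  have h1 : ∀ X Y Z : F → F,
      mvfderiv 𝓘(ℝ, F) (fun y ↦ (h.leafMetric g).inner y (asField Y y) (asField Z y)) v (asField X v)
        = fderiv ℝ (fun w ↦ pullMetric Φ g (0, w) (0, Y w) (0, Z w)) v (X v) := fun X Y Z ↦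
    DFunLike.congr_fun (F := F →L[ℝ] ℝ) (mfderiv_eq_fderiv (𝕜 := ℝ)
      (f := fun w : F ↦ pullMetric Φ g (0, w) (0, Y w) (0, Z w)) (x := v)) (X v)
  have h2 : ∀ X Y Z : F → F, (h.leafMetric g).inner v
      (VectorField.mlieBracket 𝓘(ℝ, F) (asField X) (asField Y) v) (asField Z v)
        = g.inner (Φ (0, v)) (differential Φ (0, v) (0, VectorField.lieBracket ℝ X Y v))
          (differential Φ (0, v) (0, Z v)) := fun X Y Z ↦
    congrArg (fun w ↦ (h.leafMetric g).inner v w (Z v)) (mlieBracket_asField X Y)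
  rw [koszul, koszul, mlieBracket_lift hq hX hY, mlieBracket_lift hq hX hZ,
    mlieBracket_lift hq hY hZ, lift_apply hq, lift_apply hq, lift_apply hq,
    h.mvfderiv_inner_lift hY hZ, h.mvfderiv_inner_lift hX hZ, h.mvfderiv_inner_lift hX hY,
    h1, h1, h1, h2, h2, h2]

/-- The Gauss formula: the Levi-Civita connection of a leaf is the tangential part of the
Levi-Civita connection of the ambient manifold. -/
theorem inner_leviCivita_leafMetric (h : IsAdapted ξ η ε Φ) {v : F} {Y : F → F}
    (hY : DifferentiableAt ℝ Y v) (w z : F) :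
    (h.leafMetric g).inner v (leviCivita (h.leafMetric g) (asField Y) v w) z
      = g.inner (Φ (0, v)) (leviCivita g (lift Φ Y) (Φ (0, v)) (differential Φ (0, v) (0, w)))
        (differential Φ (0, v) (0, z)) := by
  have hq := h.zero_mem_source v
  have hc : ∀ c : F, DifferentiableAt ℝ (fun _ : F ↦ c) v := fun c ↦ differentiableAt_const c
  have h1 := leviCivita_koszul (h.leafMetric g) (mdifferentiableAt_asField.2 (hc w))
    (mdifferentiableAt_asField.2 hY) (mdifferentiableAt_asField.2 (hc z))
  have h2 := leviCivita_koszul g (mdifferentiableAt_lift (Φ := Φ) hq (hc w))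
    (mdifferentiableAt_lift hq hY) (mdifferentiableAt_lift hq (hc z))
  rw [h.koszul_leafMetric (hc w) hY (hc z), ← h2, lift_apply hq, lift_apply hq] at h1
  exact mul_left_cancel₀ two_ne_zero h1

/-- `φ` preserves the leaves, and it is the same endomorphism field on all of them. -/
theorem differential_leafEnd (h : IsAdapted ξ η ε Φ) (hK : IsKenmotsu g φ ξ η) {t : ℝ}
    (ht : t ∈ Ioo (-ε) ε) (v a : F) :
    differential Φ (t, v) (0, leafEnd Φ φ v a)
      = φ (Φ (t, v)) (differential Φ (t, v) (0, a)) := by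
  have hq := h.zero_mem_source v
  have h1 : (pullEnd Φ φ (0, v) (0, a)).1 = 0 := by
    rw [← h.eta_differential _ hq, differential_pullEnd Φ hq, hK.eta_phi]
  have h2 : ((0 : ℝ), leafEnd Φ φ v a) = pullEnd Φ φ (0, v) (0, a) := Prod.ext h1.symm rfl
  rw [h2, ← h.pullEnd_eq hK ht, differential_pullEnd Φ (h.mem_source ht v)]

theorem smoothEnd_leafEnd (h : IsAdapted ξ η ε Φ) (hK : IsKenmotsu g φ ξ η) :
    SmoothEnd (M := F) (leafEnd Φ φ) univ := by
  have : CompleteSpace E := FiniteDimensional.complete ℝ E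
  refine smoothEnd_of_contDiff ?_
  rw [contDiff_iff_contDiffAt]
  intro v
  have h1 := contDiffAt_pullEnd Φ hK.smooth_phi (h.zero_mem_source v)
  exact contDiffAt_const.clm_comp ((h1.comp v (contDiff_prodMk_right (0 : ℝ)).contDiffAt).clm_comp
    contDiffAt_const)

end IsAdapted

end Leaf

/-! ### Parallel quaternionic structures -/

section Quaternionic

variable {E : Type*} [NormedAddCommGroup E] [NormedSpace ℝ E]
  {M : Type*} [TopologicalSpace M] [ChartedSpace E M] [IsManifold 𝓘(ℝ, E) ∞ M]
  {g : Metric E M} {x : M}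

namespace IsHermitianQuaternionTriple

variable {J : Fin 3 → TangentSpace 𝓘(ℝ, E) x →L[ℝ] TangentSpace 𝓘(ℝ, E) x}

theorem inner_apply_eq_zero (h : IsHermitianQuaternionTriple g x J) (i : Fin 3)
    (u : TangentSpace 𝓘(ℝ, E) x) : g.inner x u (J i u) = 0 := by
  have h1 := h.metric i u (J i u)
  rw [h.sq, map_neg, g.symm] at h1
  linarith

theorem inner_apply_apply_eq_zero (h : IsHermitianQuaternionTriple g x J) (i : Fin 3)
    (u : TangentSpace 𝓘(ℝ, E) x) : g.inner x (J i u) (J (i + 1) u) = 0 := by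
  rw [← h.metric i, h.sq, h.comp, map_neg, neg_apply, h.inner_apply_eq_zero, neg_zero]

/-- The three images of a vector under a quaternion triple are orthogonal, and therefore the
coefficients of an endomorphism with respect to the triple can be read off from its value on one
vector. -/
theorem exists_coeff (h : IsHermitianQuaternionTriple g x J)
    {A : TangentSpace 𝓘(ℝ, E) x →L[ℝ] TangentSpace 𝓘(ℝ, E) x}
    (hA : A ∈ Submodule.span ℝ (range J)) :
    ∃ c : Fin 3 → ℝ, (∀ u, A u = c 0 • J 0 u + (c 1 • J 1 u + c 2 • J 2 u)) ∧
      ∀ i u, g.inner x (A u) (J i u) = c i * g.inner x u u := by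
  obtain ⟨c, hc⟩ := (Submodule.mem_span_range_iff_exists_fun ℝ).1 hA
  have h1 : ∀ u, A u = c 0 • J 0 u + (c 1 • J 1 u + c 2 • J 2 u) := fun u ↦ by
    rw [← hc, Fin.sum_univ_three]
    simp [add_assoc]
  refine ⟨c, h1, fun i u ↦ ?_⟩
  have e01 : g.inner x (J 0 u) (J 1 u) = 0 := h.inner_apply_apply_eq_zero 0 u
  have e12 : g.inner x (J 1 u) (J 2 u) = 0 := h.inner_apply_apply_eq_zero 1 u
  have e20 : g.inner x (J 2 u) (J 0 u) = 0 := h.inner_apply_apply_eq_zero 2 u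
  have e10 := (g.symm x (J 1 u) (J 0 u)).trans e01
  have e21 := (g.symm x (J 2 u) (J 1 u)).trans e12
  have e02 := (g.symm x (J 0 u) (J 2 u)).trans e20
  rw [h1]
  fin_cases i <;> simp [e01, e12, e20, e10, e21, e02, h.metric]

end IsHermitianQuaternionTriple

variable [FiniteDimensional ℝ E]

/-- A global parallel quaternion triple makes a Riemannian manifold quaternion Kähler: the
covariant derivative of a section of the subbundle is obtained by differentiating its
coefficients. -/
theorem isQuaternionKahler_of_parallel
    {J : Fin 3 → Π x : M, TangentSpace 𝓘(ℝ, E) x →L[ℝ] TangentSpace 𝓘(ℝ, E) x}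
    (hs : ∀ i, SmoothEnd (J i) univ)
    (hJ : ∀ x, IsHermitianQuaternionTriple g x fun i ↦ J i x)
    (hp : ∀ i x v (Y : Π x : M, TangentSpace 𝓘(ℝ, E) x), MDiffAt (T% Y) x →
      nablaEnd g (J i) Y x v = 0) : IsQuaternionKahler g := by
  refine ⟨fun x ↦ Submodule.span ℝ (range fun i ↦ J i x),
    fun x₀ ↦ ⟨univ, isOpen_univ, mem_univ _, J, hs, fun x _ ↦ ⟨hJ x, rfl⟩⟩, ?_⟩
  intro U A hU hA hAQ x hx v
  by_cases htriv : ∀ u : TangentSpace 𝓘(ℝ, E) x, u = 0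
  · exact ⟨0, Submodule.zero_mem _, fun Y _ ↦ (htriv _).trans (htriv _).symm⟩
  push Not at htriv
  obtain ⟨u₀, hu₀⟩ := htriv
  -- the coefficients of `A` are differentiable, as they can be computed from the field `A u`
  let u : Π x : M, TangentSpace 𝓘(ℝ, E) x := FiberBundle.extend E u₀
  have hu : MDiffAt (T% u) x := FiberBundle.mdifferentiableAt_extend ..
  have hux : u x = u₀ := FiberBundle.extend_apply_self ..
  have hpos : 0 < g.inner x (u x) (u x) := by rw [hux]; exact g.pos x _ hu₀
  have hJd : ∀ i {Y : Π x : M, TangentSpace 𝓘(ℝ, E) x}, MDiffAt (T% Y) x →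
      MDiffAt (T% (fun y ↦ J i y (Y y))) x := fun i Y hY ↦
    mdifferentiableAt_end_apply isOpen_univ (hs i) (mem_univ x) hY
  have hn : MDiffAt (fun y ↦ g.inner y (u y) (u y)) x := mdifferentiableAt_inner hu hu
  let a : Fin 3 → M → ℝ := fun i y ↦
    g.inner y (A y (u y)) (J i y (u y)) * (g.inner y (u y) (u y))⁻¹
  have ha : ∀ i, MDiffAt (a i) x := fun i ↦
    (mdifferentiableAt_inner (mdifferentiableAt_end_apply hU hA hx hu) (hJd i hu)).mul
      ((differentiableAt_inv hpos.ne').mdifferentiableAt.comp x hn)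
  have hAa : ∀ᶠ y in 𝓝 x, ∀ w, A y w
      = a 0 y • J 0 y w + (a 1 y • J 1 y w + a 2 y • J 2 y w) := by
    filter_upwards [hU.mem_nhds hx, hn.continuousAt.eventually_ne hpos.ne'] with y hy hne w
    obtain ⟨c, hc, hci⟩ := (hJ y).exists_coeff (hAQ y hy)
    have hac : ∀ i, a i y = c i := fun i ↦ by
      change g.inner y (A y (u y)) (J i y (u y)) * (g.inner y (u y) (u y))⁻¹ = c i
      rw [hci i (u y), mul_inv_cancel_right₀ hne]
    rw [hc w, hac, hac, hac]
  refine ⟨∑ i, mvfderiv 𝓘(ℝ, E) (a i) x v • J i x, Submodule.sum_mem _ fun i _ ↦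
    Submodule.smul_mem _ _ (Submodule.subset_span ⟨i, rfl⟩), fun Y hY ↦ ?_⟩
  have hd : ∀ i, MDiffAt (T% (fun y ↦ a i y • J i y (Y y))) x := fun i ↦
    (ha i).smul_section (hJd i hY)
  have hd' : MDiffAt (T% (fun y ↦ a 1 y • J 1 y (Y y) + a 2 y • J 2 y (Y y))) x :=
    mdifferentiableAt_add_section (hd 1) (hd 2)
  have hd'' : MDiffAt (T% (fun y ↦ a 0 y • J 0 y (Y y)
      + (a 1 y • J 1 y (Y y) + a 2 y • J 2 y (Y y)))) x :=
    mdifferentiableAt_add_section (hd 0) hd'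
  have h1 : (fun y ↦ A y (Y y)) =ᶠ[𝓝 x]
      fun y ↦ a 0 y • J 0 y (Y y) + (a 1 y • J 1 y (Y y) + a 2 y • J 2 y (Y y)) := by
    filter_upwards [hAa] with y hy using hy (Y y)
  have hp' : ∀ i, leviCivita g (fun y ↦ J i y (Y y)) x v = J i x (leviCivita g Y x v) :=
    fun i ↦ sub_eq_zero.1 (hp i x v Y hY)
  rw [nablaEnd, leviCivita_congr hd'' h1,
    leviCivita_add (hd 0) hd', leviCivita_add (hd 1) (hd 2), leviCivita_smul (ha 0) (hJd 0 hY),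
    leviCivita_smul (ha 1) (hJd 1 hY), leviCivita_smul (ha 2) (hJd 2 hY), hp', hp', hp',
    hAa.self_of_nhds, Fin.sum_univ_three]
  simp only [add_apply, smul_apply]
  abel

end Quaternionic

section Leaf

variable {E : Type*} [NormedAddCommGroup E] [NormedSpace ℝ E] [FiniteDimensional ℝ E]
  {M : Type*} [TopologicalSpace M] [ChartedSpace E M] [IsManifold 𝓘(ℝ, E) ∞ M]
  {F : Type*} [NormedAddCommGroup F] [NormedSpace ℝ F] [FiniteDimensional ℝ F]
  {g : Metric E M} {φ : Π x : M, TangentSpace 𝓘(ℝ, E) x →L[ℝ] TangentSpace 𝓘(ℝ, E) x}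
  {ξ : Π x : M, TangentSpace 𝓘(ℝ, E) x} {η : Π x : M, TangentSpace 𝓘(ℝ, E) x →L[ℝ] ℝ} {ε : ℝ}
  {Φ : PartialDiffeomorph 𝓘(ℝ, ℝ × F) 𝓘(ℝ, E) (ℝ × F) M ∞}

namespace IsAdapted

theorem leafMetric_leafEnd_left (h : IsAdapted ξ η ε Φ) (hK : IsKenmotsu g φ ξ η) (v a b : F) :
    (h.leafMetric g).inner v (leafEnd Φ φ v a) b
      = -(h.leafMetric g).inner v a (leafEnd Φ φ v b) := by
  simp only [h.leafMetric_inner, pullMetric_apply, h.differential_leafEnd hK h.zero_mem_Ioo]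
  exact hK.inner_phi_left _ _ _

/-- By the Gauss formula, the induced endomorphism field on a leaf is parallel: in the Kenmotsu
identity, both terms on the right-hand side are normal to the leaf or vanish. -/
theorem nablaEnd_leafEnd (h : IsAdapted ξ η ε Φ) (hK : IsKenmotsu g φ ξ η) {v : F} {Y : F → F}
    (hY : DifferentiableAt ℝ Y v) (w : F) :
    nablaEnd (h.leafMetric g) (leafEnd Φ φ) (asField Y) v w = 0 := by
  have hq := h.zero_mem_source v
  have hdiff : ∀ v a : F, differential Φ (0, v) (0, leafEnd Φ φ v a)
      = φ (Φ (0, v)) (differential Φ (0, v) (0, a)) := h.differential_leafEnd hK h.zero_mem_Ioo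
  have hJY : DifferentiableAt ℝ (fun y ↦ leafEnd Φ φ y (Y y)) v :=
    mdifferentiableAt_asField.1 (mdifferentiableAt_end_apply isOpen_univ (h.smoothEnd_leafEnd hK)
      (mem_univ v) (mdifferentiableAt_asField.2 hY))
  have hL := mdifferentiableAt_lift (Φ := Φ) hq hY
  have hlift : lift Φ (fun y ↦ leafEnd Φ φ y (Y y)) =ᶠ[𝓝 (Φ (0, v))]
      fun y ↦ φ y (lift Φ Y y) :=
    eventually_target Φ hq fun x hx ↦ by
      have hx1 : x.1 ∈ Ioo (-ε) ε := by
        rw [h.source_eq] at hx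
        exact hx.1
      exact (lift_apply hx _).trans ((h.differential_leafEnd hK hx1 x.2 (Y x.2)).trans
        (congrArg (φ (Φ x)) (lift_apply hx Y)).symm)
  have hmain : ∀ z : F, (h.leafMetric g).inner v
        (leviCivita (h.leafMetric g) (asField fun y ↦ leafEnd Φ φ y (Y y)) v w) z
      = (h.leafMetric g).inner v
          (leafEnd Φ φ v (leviCivita (h.leafMetric g) (asField Y) v w)) z := by
    intro z
    have h1 := hK.nabla_phi _ (differential Φ (0, v) (0, w)) _ hL
    rw [nablaEnd, sub_eq_iff_eq_add, lift_apply hq, h.eta_differential _ hq, zero_smul,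
      sub_zero] at h1
    rw [h.inner_leviCivita_leafMetric hJY, leviCivita_congr (hK.mdifferentiableAt_phi hL) hlift, h1,
      map_add, map_smul, add_apply, smul_apply, ← hK.eta_dual, h.eta_differential _ hq, smul_zero,
      zero_add, hK.inner_phi_left, ← hdiff, ← h.inner_leviCivita_leafMetric hY]
    exact (h.leafMetric_leafEnd_left hK v _ z).symm
  exact sub_eq_zero.2 (eq_of_inner_eq (h.leafMetric g) hmain)

variable {φ : Fin 3 → Π x : M, TangentSpace 𝓘(ℝ, E) x →L[ℝ] TangentSpace 𝓘(ℝ, E) x}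

theorem isHermitianQuaternionTriple_leafEnd (h : IsAdapted ξ η ε Φ)
    (hM : IsThreeKenmotsu g φ ξ η) (v : F) :
    IsHermitianQuaternionTriple (h.leafMetric g) v fun i ↦ (leafEnd Φ (φ i) v : F →L[ℝ] F) := by
  have hq := h.zero_mem_source v
  have hdiff : ∀ (i : Fin 3) (a : F), differential Φ (0, v) (0, leafEnd Φ (φ i) v a)
      = φ i (Φ (0, v)) (differential Φ (0, v) (0, a)) := fun i ↦
    h.differential_leafEnd (hM.kenmotsu i) h.zero_mem_Ioo v
  have hneg : ∀ a : F, differential Φ (0, v) (0, -a) = -differential Φ (0, v) (0, a) := fun a ↦ by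
    rw [← map_neg, Prod.neg_mk, neg_zero]
  refine ⟨fun i (a : F) ↦ h.eq_of_differential_eq (v := v) ?_,
    fun i (a : F) ↦ h.eq_of_differential_eq (v := v) ?_,
    fun i (a : F) ↦ h.eq_of_differential_eq (v := v) ?_, fun i (a b : F) ↦ ?_⟩
  · refine (hdiff i _).trans ((congrArg _ (hdiff i a)).trans (.trans ?_ (hneg a).symm))
    rw [(hM.kenmotsu i).phi_sq, h.eta_differential _ hq, zero_smul, add_zero]
  · refine (hdiff i _).trans ((congrArg _ (hdiff _ a)).trans (.trans ?_ (hdiff _ a).symm))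
    rw [hM.comp]
  · refine (hdiff _ _).trans ((congrArg _ (hdiff i a)).trans
      (.trans ?_ ((hneg _).trans (congrArg _ (hdiff _ a))).symm))
    rw [hM.phi_anticomp]
  · change g.inner (Φ (0, v)) (differential Φ (0, v) (0, leafEnd Φ (φ i) v a))
      (differential Φ (0, v) (0, leafEnd Φ (φ i) v b)) = g.inner (Φ (0, v))
        (differential Φ (0, v) (0, a)) (differential Φ (0, v) (0, b))
    rw [hdiff, hdiff, (hM.kenmotsu i).metric_phi, h.eta_differential _ hq, zero_mul, sub_zero]

theorem isQuaternionKahler_leafMetric (h : IsAdapted ξ η ε Φ) (hM : IsThreeKenmotsu g φ ξ η) :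
    IsQuaternionKahler (h.leafMetric g) :=
  isQuaternionKahler_of_parallel (J := fun i ↦ leafEnd Φ (φ i))
    (fun i ↦ h.smoothEnd_leafEnd (hM.kenmotsu i)) (h.isHermitianQuaternionTriple_leafEnd hM)
    fun i _ w _ hY ↦ h.nablaEnd_leafEnd (hM.kenmotsu i) (mdifferentiableAt_asField.1 hY) w

end IsAdapted

end Leaf

/-! ### The dimension of a 3-Kenmotsu manifold -/

open scoped Quaternion in
/-- A vector space with two anticommuting complex structures is a vector space over the
quaternions. -/
theorem four_dvd_finrank {H : Type*} [AddCommGroup H] [Module ℝ H] (I J : Module.End ℝ H)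
    (hI : I * I = -1) (hJ : J * J = -1) (hIJ : J * I = -(I * J)) :
    4 ∣ Module.finrank ℝ H := by
  let B : QuaternionAlgebra.Basis (Module.End ℝ H) (-1 : ℝ) 0 (-1) :=
    { i := I
      j := J
      k := I * J
      i_mul_i := by simp [hI]
      j_mul_j := by simp [hJ]
      i_mul_j := rfl
      j_mul_i := by simp [hIJ] }
  let f : ℍ[ℝ] →ₐ[ℝ] Module.End ℝ H := B.liftHom
  let _ : Module ℍ[ℝ] H := Module.compHom H f.toRingHom
  have : IsScalarTower ℝ ℍ[ℝ] H := ⟨fun r q v ↦ by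
    change f (r • q) v = r • f q v
    rw [map_smul]
    rfl⟩
  have h := Module.finrank_mul_finrank ℝ ℍ[ℝ] H
  rw [Quaternion.finrank_eq_four] at h
  exact ⟨_, h.symm⟩

theorem exists_finrank_eq {E : Type*} [AddCommGroup E] [Module ℝ E] [FiniteDimensional ℝ E]
    (I J : E →ₗ[ℝ] E) (η : E →ₗ[ℝ] ℝ) (ξ : E) (hξ : η ξ = 1)
    (hI : ∀ v, I (I v) = -v + η v • ξ) (hJ : ∀ v, J (J v) = -v + η v • ξ)
    (hηI : ∀ v, η (I v) = 0) (hηJ : ∀ v, η (J v) = 0) (hIJ : ∀ v, J (I v) = -I (J v)) :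
    ∃ n, 4 * n + 1 = Module.finrank ℝ E := by
  let I' : Module.End ℝ (LinearMap.ker η) := I.restrict fun v _ ↦ hηI v
  let J' : Module.End ℝ (LinearMap.ker η) := J.restrict fun v _ ↦ hηJ v
  obtain ⟨n, hn⟩ := four_dvd_finrank I' J'
    (LinearMap.ext fun v ↦ Subtype.ext (by
      have hv : η v = 0 := v.2
      change I (I v) = -(v : E)
      rw [hI, hv, zero_smul, add_zero]))
    (LinearMap.ext fun v ↦ Subtype.ext (by
      have hv : η v = 0 := v.2
      change J (J v) = -(v : E)
      rw [hJ, hv, zero_smul, add_zero]))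
    (LinearMap.ext fun v ↦ Subtype.ext (hIJ v))
  have h1 := LinearMap.finrank_range_add_finrank_ker η
  have h2 : LinearMap.range η = ⊤ := LinearMap.range_eq_top.2 fun r ↦ ⟨r • ξ, by simp [hξ]⟩
  rw [h2, finrank_top, Module.finrank_self] at h1
  exact ⟨n, by omega⟩

theorem IsThreeKenmotsu.exists_finrank_eq {E : Type*} [NormedAddCommGroup E] [NormedSpace ℝ E]
    [FiniteDimensional ℝ E] {M : Type*} [TopologicalSpace M] [ChartedSpace E M]
    [IsManifold 𝓘(ℝ, E) ∞ M] {g : Metric E M}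
    {φ : Fin 3 → Π x : M, TangentSpace 𝓘(ℝ, E) x →L[ℝ] TangentSpace 𝓘(ℝ, E) x}
    {ξ : Π x : M, TangentSpace 𝓘(ℝ, E) x} {η : Π x : M, TangentSpace 𝓘(ℝ, E) x →L[ℝ] ℝ}
    (hM : IsThreeKenmotsu g φ ξ η) (p : M) : ∃ n, 4 * n + 1 = Module.finrank ℝ E := by
  have : FiniteDimensional ℝ (TangentSpace 𝓘(ℝ, E) p) := inferInstanceAs (FiniteDimensional ℝ E)
  exact ThreeKenmotsu.exists_finrank_eq (E := TangentSpace 𝓘(ℝ, E) p)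
    (φ 0 p) (φ 1 p) (η p) (ξ p)
    ((hM.kenmotsu 0).eta_xi p) ((hM.kenmotsu 0).phi_sq p) ((hM.kenmotsu 1).phi_sq p)
    ((hM.kenmotsu 0).eta_phi p) ((hM.kenmotsu 1).eta_phi p)
    fun v ↦ (hM.phi_anticomp 0 p v).trans (congrArg _ (hM.comp 0 p v))

/-! ### The product structure on `ℝ × F` -/

section Product

variable {E : Type*} [NormedAddCommGroup E] [NormedSpace ℝ E]
  {M : Type*} [TopologicalSpace M] [ChartedSpace E M]
  {F : Type*} [NormedAddCommGroup F] [NormedSpace ℝ F]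

theorem contMDiffOn_prod_left {f : ℝ × F → M} {s : Set (ℝ × F)}
    (hf : ContMDiffOn 𝓘(ℝ, ℝ × F) 𝓘(ℝ, E) ∞ f s) :
    ContMDiffOn (𝓘(ℝ, ℝ).prod 𝓘(ℝ, F)) 𝓘(ℝ, E) ∞ f s := by
  rw [modelWithCornersSelf_prod, ← chartedSpaceSelf_prod] at hf
  exact hf

theorem contMDiffOn_prod_right {f : M → ℝ × F} {s : Set M}
    (hf : ContMDiffOn 𝓘(ℝ, E) 𝓘(ℝ, ℝ × F) ∞ f s) :
    ContMDiffOn 𝓘(ℝ, E) (𝓘(ℝ, ℝ).prod 𝓘(ℝ, F)) ∞ f s := by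
  rw [modelWithCornersSelf_prod, ← chartedSpaceSelf_prod] at hf
  exact hf

theorem mfderiv_prod_left (f : ℝ × F → M) (q : ℝ × F) :
    (mfderiv (𝓘(ℝ, ℝ).prod 𝓘(ℝ, F)) 𝓘(ℝ, E) f q : ℝ × F →L[ℝ] E)
      = (mfderiv 𝓘(ℝ, ℝ × F) 𝓘(ℝ, E) f q : ℝ × F →L[ℝ] E) := by
  rw [← modelWithCornersSelf_prod, ← chartedSpaceSelf_prod]

/-- A partial diffeomorphism from the vector space `ℝ × F`, regarded as one from the product of
the manifolds `ℝ` and `F`. -/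
def toProd (Φ : PartialDiffeomorph 𝓘(ℝ, ℝ × F) 𝓘(ℝ, E) (ℝ × F) M ∞) :
    PartialDiffeomorph (𝓘(ℝ, ℝ).prod 𝓘(ℝ, F)) 𝓘(ℝ, E) (ℝ × F) M ∞ where
  toPartialEquiv := Φ.toPartialEquiv
  open_source := Φ.open_source
  open_target := Φ.open_target
  contMDiffOn_toFun := contMDiffOn_prod_left Φ.contMDiffOn_toFun
  contMDiffOn_invFun := contMDiffOn_prod_right Φ.contMDiffOn_invFun

theorem mfderiv_toProd (Φ : PartialDiffeomorph 𝓘(ℝ, ℝ × F) 𝓘(ℝ, E) (ℝ × F) M ∞)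
    (q : ℝ × F) (a : ℝ × F) :
    mfderiv (𝓘(ℝ, ℝ).prod 𝓘(ℝ, F)) 𝓘(ℝ, E) (toProd Φ) q a = differential Φ q a :=
  DFunLike.congr_fun (F := ℝ × F →L[ℝ] E) (mfderiv_prod_left Φ q) a

end Product

/-- In adapted coordinates the metric is the warped product of `dt²` and the metric of the leaf
`{t = 0}`. -/
theorem IsAdapted.inner_differential {E : Type*} [NormedAddCommGroup E] [NormedSpace ℝ E]
    [FiniteDimensional ℝ E] {M : Type*} [TopologicalSpace M] [ChartedSpace E M]
    [IsManifold 𝓘(ℝ, E) ∞ M] {F : Type*} [NormedAddCommGroup F] [NormedSpace ℝ F]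
    [FiniteDimensional ℝ F] {g : Metric E M}
    {φ : Π x : M, TangentSpace 𝓘(ℝ, E) x →L[ℝ] TangentSpace 𝓘(ℝ, E) x}
    {ξ : Π x : M, TangentSpace 𝓘(ℝ, E) x} {η : Π x : M, TangentSpace 𝓘(ℝ, E) x →L[ℝ] ℝ} {ε : ℝ}
    {Φ : PartialDiffeomorph 𝓘(ℝ, ℝ × F) 𝓘(ℝ, E) (ℝ × F) M ∞}
    (h : IsAdapted ξ η ε Φ) (hK : IsKenmotsu g φ ξ η) {q : ℝ × F} (hq : q ∈ Φ.source)
    (a b : ℝ × F) :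
    g.inner (Φ q) (differential Φ q a) (differential Φ q b)
      = a.1 * b.1 + Real.exp q.1 ^ 2 * (h.leafMetric g).inner q.2 a.2 b.2 := by
  have hsplit : ∀ a : ℝ × F,
      differential Φ q a = a.1 • ξ (Φ q) + differential Φ q (0, a.2) := fun a ↦ by
    rw [← h.differential_fst q hq, ← map_smul, ← map_add]
    simp
  have ht : q.1 ∈ Ioo (-ε) ε := by
    have := hq
    rw [h.source_eq] at this
    exact this.1
  have h1 := h.pullMetric_eq hK ht q.2 a.2 b.2
  rw [pullMetric_apply] at h1
  have h2 : ∀ c : F, g.inner (Φ q) (ξ (Φ q)) (differential Φ q (0, c)) = 0 := fun c ↦ by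
    rw [← hK.eta_dual, h.eta_differential q hq]
  have h3 : ∀ c : F, g.inner (Φ q) (differential Φ q (0, c)) (ξ (Φ q)) = 0 := fun c ↦
    (g.symm _ _ _).trans (h2 c)
  rw [hsplit a, hsplit b, h.leafMetric_inner, ← h1]
  simp [h2, h3, hK.inner_xi_xi]

end ThreeKenmotsu

end

/-! ### Local structure of 3-Kenmotsu manifolds -/

theorem mainTheorem3
    {E : Type*} [NormedAddCommGroup E] [NormedSpace ℝ E] [FiniteDimensional ℝ E]
    {M : Type*} [TopologicalSpace M] [ChartedSpace E M] [IsManifold 𝓘(ℝ, E) ∞ M]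
    (g : ThreeKenmotsu.Metric E M)
    (φ : Fin 3 → Π x : M, TangentSpace 𝓘(ℝ, E) x →L[ℝ] TangentSpace 𝓘(ℝ, E) x)
    (ξ : Π x : M, TangentSpace 𝓘(ℝ, E) x)
    (η : Π x : M, TangentSpace 𝓘(ℝ, E) x →L[ℝ] ℝ)
    (hM : ThreeKenmotsu.IsThreeKenmotsu g φ ξ η) (p : M) :
    ∃ (n : ℕ) (V : Type) (_ : TopologicalSpace V) (_ : T2Space V) (_ : SecondCountableTopology V)
      (_ : ChartedSpace (EuclideanSpace ℝ (Fin (4 * n))) V)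
      (_ : IsManifold 𝓘(ℝ, EuclideanSpace ℝ (Fin (4 * n))) ∞ V)
      (h : ThreeKenmotsu.Metric (EuclideanSpace ℝ (Fin (4 * n))) V)
      (ε c : ℝ)
      (Φ : PartialDiffeomorph (𝓘(ℝ, ℝ).prod 𝓘(ℝ, EuclideanSpace ℝ (Fin (4 * n)))) 𝓘(ℝ, E)
        (ℝ × V) M ∞),
      0 < ε ∧ 0 < c ∧ ThreeKenmotsu.IsQuaternionKahler h ∧
      Φ.source = Ioo (-ε) ε ×ˢ univ ∧ p ∈ Φ.target ∧
      ∀ q ∈ Φ.source,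
        ∀ a b : TangentSpace (𝓘(ℝ, ℝ).prod 𝓘(ℝ, EuclideanSpace ℝ (Fin (4 * n)))) q,
          g.inner (Φ q)
              (mfderiv (𝓘(ℝ, ℝ).prod 𝓘(ℝ, EuclideanSpace ℝ (Fin (4 * n)))) 𝓘(ℝ, E) Φ q a)
              (mfderiv (𝓘(ℝ, ℝ).prod 𝓘(ℝ, EuclideanSpace ℝ (Fin (4 * n)))) 𝓘(ℝ, E) Φ q b)
            = ThreeKenmotsu.warpedInner (fun t ↦ c * Real.exp t) h q a b := by
  obtain ⟨n, hn⟩ := hM.exists_finrank_eq p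
  obtain ⟨ε, Φ, hΦ, hp⟩ := ThreeKenmotsu.exists_isAdapted
    (F := EuclideanSpace ℝ (Fin (4 * n))) (hM.kenmotsu 0) p (by rw [finrank_euclideanSpace_fin, hn])
  -- no rescaling is needed, since `h` is the metric of the leaf at `t = 0`: thus `c = 1`
  refine ⟨n, EuclideanSpace ℝ (Fin (4 * n)), inferInstance,
    TopologicalSpace.t2Space_of_metrizableSpace, inferInstance, inferInstance, inferInstance,
    hΦ.leafMetric g, ε, 1, ThreeKenmotsu.toProd Φ, hΦ.pos, one_pos,
    hΦ.isQuaternionKahler_leafMetric hM, hΦ.source_eq, hp, fun q hq a b ↦ ?_⟩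
  rw [ThreeKenmotsu.warpedInner, one_mul]
  exact (congrArg₂ (fun v w ↦ g.inner (Φ q) v w) (ThreeKenmotsu.mfderiv_toProd Φ q a)
    (ThreeKenmotsu.mfderiv_toProd Φ q b)).trans (hΦ.inner_differential (hM.kenmotsu 0) hq a b)
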